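/- A circular nowhere-zero $r$-flow ($r\ge 2$ real) in a finite graph $G$ is an orientation of $G$ together with a function $f\colon E(G)\to[1,r-1]$ such that at every vertex the sum of the incoming values equals the sum of the outgoing ones; the circular flow number $\Phi_c(G)$ is the least real $r \ge 2$ such that $G$ has a circular nowhere-zero $r$-flow. A snark is a cyclically $4$-edge-connected cubic graph of girth at least $5$ without a proper $3$-edge-colouring. Let $G,H$ be cubic graphs, let $ab,cd$ be independent edges of $G$, let $x,y$ be adjacent vertices of $H$, let $u,v$ be the other two neighbours of $x$ and $w,z$ those of $y$. The dot product of $G$ and $H$ with respect to these choices is obtained from the disjoint union of $G-\{ab,cd\}$ and $H-\{x,y\}$ by adding the edges $au,bv,cw,dz$. Let $P$ be the Petersen graph with vertices $0,\dots,9$, outer cycle $0\,1\,2\,3\,4$, inner cycle $5\,7\,9\,6\,8$ and spokes $05,16,27,38,49$. Define graphs $S_k$ ($k\ge1$), each with two selected independent edges $a_kb_k$ and $c_kd_k$, as follows. - $S_1=P$, with $(a_1,b_1,c_1,d_1)=(0,1,4,3)$. - For $k\ge 2$, $S_k$ is the dot product of $S_{k-1}$, with respect to $a_{k-1}b_{k-1}$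 and $c_{k-1}d_{k-1}$, and a new copy of $P$, with respect to $x=0$, $y=1$, $u=4$, $v=5$, $w=2$, $z=6$; that is, the new edges are $a_{k-1}4$, $b_{k-1}5$, $c_{k-1}2$, $d_{k-1}6$. Moreover $(a_k,b_k,c_k,d_k)=(6,d_{k-1},3,4)$, where $6,3,4$ denote vertices of the new copy of $P$. **Theorem.** For every integer $k\ge1$, $S_k$ is a snark of order $8k+2$, and $\Phi_c(S_k)=4+\frac1k$. -/

import Mathlib

open scoped Classical in
/-- A circular nowhere-zero `r`-flow in a finite graph `G`: an orientation of `G` (`dir u v` says that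
the edge `uv` is directed from `u` to `v`) together with a function on the edges with values in
`[1, r - 1]` such that at every vertex the incoming and the outgoing flow agree. -/
structure CircularNowhereZeroFlow {V : Type} [Fintype V] (G : SimpleGraph V) (r : ℝ) where
  dir : V → V → Prop
  adj_iff : ∀ u v, G.Adj u v ↔ (dir u v ∨ dir v u)
  asymm : ∀ u v, dir u v → ¬ dir v u
  f : Sym2 V → ℝ
  mem_Icc : ∀ e ∈ G.edgeSet, f e ∈ Set.Icc 1 (r - 1)
  conservation : ∀ v,
    (∑ u : V, if dir u v then f s(u, v) else 0) = ∑ u : V, if dir v u then f s(v, u) else 0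

/-- `r` is the circular flow number of `G`: the least real number `r ≥ 2` such that `G` has a
circular nowhere-zero `r`-flow. -/
def IsCircularFlowNumber {V : Type} [Fintype V] (G : SimpleGraph V) (r : ℝ) : Prop :=
  IsLeast {t : ℝ | 2 ≤ t ∧ Nonempty (CircularNowhereZeroFlow G t)} r

/-- The edges of `G` with exactly one end in `X`. -/
def edgeBoundary {V : Type} (G : SimpleGraph V) (X : Set V) : Set (Sym2 V) :=
  {e | ∃ u v, u ∈ X ∧ v ∉ X ∧ G.Adj u v ∧ e = s(u, v)}

/-- Every edge cut of `G` which leaves a cycle on both of its sides has at least `m` edges. -/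
def CyclicallyEdgeConnected {V : Type} (G : SimpleGraph V) (m : ℕ) : Prop :=
  ∀ X : Set V, ¬ (G.induce X).IsAcyclic → ¬ (G.induce Xᶜ).IsAcyclic →
    (m : ℕ∞) ≤ (edgeBoundary G X).encard

/-- Every vertex has exactly three neighbours. -/
def IsCubic {V : Type} (G : SimpleGraph V) : Prop :=
  ∀ v, (G.neighborSet v).encard = 3

/-- A snark is a cyclically 4-edge-connected cubic graph of girth at least 5 which has no proper
edge-colouring with three colours. -/
structure IsSnark {V : Type} (G : SimpleGraph V) : Prop where
  cubic : IsCubic G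
  cyclicallyEdgeConnected : CyclicallyEdgeConnected G 4
  girth : 5 ≤ G.egirth
  not_colorable : ¬ G.lineGraph.Colorable 3

/-- The dot product `G · H` with respect to the independent edges `ab`, `cd` of `G` and to the adjacent
vertices `x`, `y` of `H`, where `u`, `v` are the other neighbours of `x` and `w`, `z` those of `y`:
delete the edges `ab`, `cd` from `G` and the vertices `x`, `y` from `H`, and add the edges
`au`, `bv`, `cw`, `dz`. -/
def graphDotProduct {V W : Type} (G : SimpleGraph V) (a b c d : V)
    (H : SimpleGraph W) (x y u v w z : W) :
    SimpleGraph (V ⊕ {h : W // h ≠ x ∧ h ≠ y}) :=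
  (G.deleteEdges {s(a, b), s(c, d)} ⊕g H.comap (Subtype.val : {h : W // h ≠ x ∧ h ≠ y} → W)) ⊔
    SimpleGraph.fromRel fun s t =>
      ∃ (g : V) (h : {h : W // h ≠ x ∧ h ≠ y}), s = Sum.inl g ∧ t = Sum.inr h ∧
        ((g = a ∧ h.1 = u) ∨ (g = b ∧ h.1 = v) ∨ (g = c ∧ h.1 = w) ∨ (g = d ∧ h.1 = z))

/-- The Petersen graph: the outer 5-cycle `0 1 2 3 4`, the inner 5-cycle `5 7 9 6 8`, and the five
spokes. -/
def petersenGraph : SimpleGraph (Fin 10) :=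
  SimpleGraph.fromEdgeSet
    {s(0, 1), s(1, 2), s(2, 3), s(3, 4), s(4, 0),
     s(5, 7), s(7, 9), s(9, 6), s(6, 8), s(8, 5),
     s(0, 5), s(1, 6), s(2, 7), s(3, 8), s(4, 9)}

/-- A finite graph with two selected independent edges `ab` and `cd`, each with a fixed order of its
two ends. -/
structure MarkedGraph where
  V : Type
  fintypeV : Fintype V
  graph : SimpleGraph V
  a : V
  b : V
  c : V
  d : V
  adj_ab : graph.Adj a b
  adj_cd : graph.Adj c d
  ne_ac : a ≠ c
  ne_ad : a ≠ d
  ne_bc : b ≠ c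
  ne_bd : b ≠ d

attribute [instance] MarkedGraph.fintypeV

/-- The Petersen graph with the selected edges `01` and `43`, which are at distance 1. -/
def markedPetersen : MarkedGraph where
  V := Fin 10
  fintypeV := inferInstance
  graph := petersenGraph
  a := 0
  b := 1
  c := 4
  d := 3
  adj_ab := by simp [petersenGraph]
  adj_cd := by simp [petersenGraph]
  ne_ac := by decide
  ne_ad := by decide
  ne_bc := by decide
  ne_bd := by decide

/-- The dot product of `M`, with respect to its selected edges `ab` and `cd`, and a new copy of the
Petersen graph, with respect to its adjacent vertices `0` and `1`. The other neighbours of `0` are `4`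
and `5`, those of `1` are `2` and `6`, so the new edges are `a4`, `b5`, `c2`, `d6`. The edges selected
for the next step are the new edge from `6` to `d`, and the edge from `3` to `4` of the new copy (with
their ends in this order). -/
def MarkedGraph.dotPetersen (M : MarkedGraph) : MarkedGraph where
  V := M.V ⊕ {h : Fin 10 // h ≠ 0 ∧ h ≠ 1}
  fintypeV := inferInstance
  graph := graphDotProduct M.graph M.a M.b M.c M.d petersenGraph 0 1 4 5 2 6
  a := Sum.inr ⟨6, by decide⟩
  b := Sum.inl M.d
  c := Sum.inr ⟨3, by decide⟩
  d := Sum.inr ⟨4, by decide⟩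
  adj_ab := by simp [graphDotProduct]
  adj_cd := by simp [graphDotProduct, petersenGraph]
  ne_ac := by simp
  ne_ad := by simp
  ne_bc := by simp
  ne_bd := by simp

/-- The recursive construction of the graphs `S_k` for `k ≥ 1`: `S_1` is the Petersen graph, and
`S_{k+1}` is the above dot product of `S_k` with a Petersen graph. The value at `0` is irrelevant. -/
def snarkFamily : ℕ → MarkedGraph
  | 0 => markedPetersen
  | 1 => markedPetersen
  | k + 2 => (snarkFamily (k + 1)).dotPetersen

/-! Taking a dot product with the Petersen graph attaches one fixed piece to the old graph along
four edges: the Petersen graph without the adjacent vertices 0 and 1. Its edge 34 and its connecting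
edge at 6 are then cut for the next step. So S_k is a chain of k such pieces, ended on one side by
the vertices 0 and 1 of the first Petersen graph and on the other by the two selected edges.
Degrees, 3-edge-colourings and circular flows are all arc valuations with values in a set `B` and
vertex sums in a set `D`. By `MarkedGraph.HasValuation.restrict` and
`MarkedGraph.HasValuation.extend` they can be studied one piece at a time.

Lower bound. In a cubic graph every vertex has one edge directed against the other two. Subtracting
r/2 from every flow value therefore gives values of modulus at most 1 + ε/2 and vertex sums ±(2 +
ε/2), where ε = r - 4. Call the sum of the values on the two half-edges at 3 and 4 the defect of a
piece. In the last piece it is 0, since these are the halves of one edge. As long as the bounds stay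
below 1, passing through a piece raises the bound on the defect by at most ε
(`PieceValuable.abs_add_le`). If kε < 1, the two edges from the first piece to vertex 0 then have a
sum of modulus below 1. The third edge at 0 adds at most 1 + ε/2, which is too little for 2 + ε/2.
Hence ε ≥ 1/k. A 3-edge-colouring is excluded by the same induction in the Klein four-group, with
defect 0 throughout; both cases are instances of `not_isValuation_snarkFamily`.

Upper bound. There is an explicit flow whose defect grows by exactly 1/k from piece to piece, and it
closes up after k pieces.

Girth and connectivity go by induction. For the latter the stronger property `OnlyTrivialSmallCuts`
is the one that passes to dot products. -/

/-- `φ` assigns to each arc of `G` a value in `B`, the value of the reverse arc being its image under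
`σ`, such that the values leaving a vertex `v`, together with `ext v`, have their sum in `D`. -/
structure IsValuation {V A : Type} [Fintype V] [AddCommMonoid A] (σ : A → A) (B D : Set A)
    (G : SimpleGraph V) (φ : V → V → A) (ext : V → A) : Prop where
  symm : ∀ u v, φ v u = σ (φ u v)
  eq_zero : ∀ u v, ¬ G.Adj u v → φ u v = 0
  mem : ∀ u v, G.Adj u v → φ u v ∈ B
  sum_mem : ∀ v, ∑ u, φ v u + ext v ∈ D

/-! ### Cutting and rejoining the selected edges -/

namespace MarkedGraph

/-- The graph without its two selected edges. -/
def cutGraph (M : MarkedGraph) : SimpleGraph M.V :=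
  M.graph.deleteEdges {s(M.a, M.b), s(M.c, M.d)}

open scoped Classical in
/-- The function with the values `α`, `β`, `γ`, `δ` at the ends `a`, `b`, `c`, `d` of the selected
edges, and `0` elsewhere. -/
noncomputable def ends {A : Type} [AddCommMonoid A] (M : MarkedGraph) (α β γ δ : A) (v : M.V) : A :=
  (if v = M.a then α else 0) + (if v = M.b then β else 0) + (if v = M.c then γ else 0) +
    (if v = M.d then δ else 0)

/-- The graph has a valuation when its selected edges `ab`, `cd` are cut, with the values
`α`, `β`, `γ`, `δ` leaving `a`, `b`, `c`, `d` through the half-edges. -/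
def HasValuation {A : Type} [AddCommMonoid A] (σ : A → A) (B D : Set A) (M : MarkedGraph)
    (α β γ δ : A) : Prop :=
  α ∈ B ∧ β ∈ B ∧ γ ∈ B ∧ δ ∈ B ∧ ∃ φ, IsValuation σ B D M.cutGraph φ (M.ends α β γ δ)

section

variable {A : Type} [AddCommMonoid A] {M : MarkedGraph} (α β γ δ : A)

theorem ends_a : M.ends α β γ δ M.a = α := by
  simp [ends, M.adj_ab.ne, M.ne_ac, M.ne_ad]

theorem ends_b : M.ends α β γ δ M.b = β := by
  simp [ends, M.adj_ab.ne', M.ne_bc, M.ne_bd]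

theorem ends_c : M.ends α β γ δ M.c = γ := by
  simp [ends, M.adj_cd.ne, M.ne_ac.symm, M.ne_bc.symm]

theorem ends_d : M.ends α β γ δ M.d = δ := by
  simp [ends, M.adj_cd.ne', M.ne_ad.symm, M.ne_bd.symm]

theorem ends_of_ne {v : M.V} (ha : v ≠ M.a) (hb : v ≠ M.b) (hc : v ≠ M.c) (hd : v ≠ M.d) :
    M.ends α β γ δ v = 0 := by
  simp [ends, ha, hb, hc, hd]

/-- A property of all vertices follows from its cases for the four selected and for the other
vertices. -/
theorem forall_of_ends {p : M.V → Prop} (ha : p M.a) (hb : p M.b) (hc : p M.c) (hd : p M.d)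
    (h : ∀ v, v ≠ M.a → v ≠ M.b → v ≠ M.c → v ≠ M.d → p v) (v : M.V) : p v := by
  by_cases h1 : v = M.a
  · exact h1 ▸ ha
  by_cases h2 : v = M.b
  · exact h2 ▸ hb
  by_cases h3 : v = M.c
  · exact h3 ▸ hc
  by_cases h4 : v = M.d
  · exact h4 ▸ hd
  exact h v h1 h2 h3 h4

end

theorem cutGraph_adj {M : MarkedGraph} {u v : M.V} : M.cutGraph.Adj u v ↔
    M.graph.Adj u v ∧ ¬ (u = M.a ∧ v = M.b ∨ u = M.b ∧ v = M.a) ∧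
      ¬ (u = M.c ∧ v = M.d ∨ u = M.d ∧ v = M.c) := by
  simp [cutGraph, SimpleGraph.deleteEdges_adj]

section

variable {A : Type} [AddCommMonoid A] {σ : A → A} {B D : Set A} {M : MarkedGraph}

/-- Cutting an edge leaves its value on one half-edge and the `σ`-image of that value on the other.
-/
theorem hasValuation_of_isValuation {φ : M.V → M.V → A}
    (h : IsValuation σ B D M.graph φ 0) (hσ : σ 0 = 0) :
    ∃ α ∈ B, ∃ γ ∈ B, M.HasValuation σ B D α (σ α) γ (σ γ) := by
  classical
  refine ⟨φ M.a M.b, h.mem _ _ M.adj_ab, φ M.c M.d, h.mem _ _ M.adj_cd, h.mem _ _ M.adj_ab, ?_,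
    h.mem _ _ M.adj_cd, ?_, fun u v => if M.cutGraph.Adj u v then φ u v else 0, ?_⟩
  · exact h.symm _ _ ▸ h.mem _ _ M.adj_ab.symm
  · exact h.symm _ _ ▸ h.mem _ _ M.adj_cd.symm
  refine ⟨fun u v => ?_, fun u v huv => if_neg huv, fun u v huv => ?_, ?_⟩
  · simp only [M.cutGraph.adj_comm v u]
    split_ifs
    · exact h.symm u v
    · exact hσ.symm
  · rw [if_pos huv]
    exact h.mem _ _ (cutGraph_adj.1 huv).1
  -- Deleting the selected edge at `v` removes the summand of its other end `w`; the half-edge value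
  -- `x` puts it back.
  have key : ∀ v w x, (∀ u, M.cutGraph.Adj v u ↔ M.graph.Adj v u ∧ u ≠ w) → x = φ v w →
      ∑ u, (if M.cutGraph.Adj v u then φ v u else 0) + x ∈ D := by
    intro v w x hw hx
    have h1 := h.sum_mem v
    rw [Pi.zero_apply, add_zero] at h1
    convert h1 using 1
    rw [← Finset.sum_erase_add _ _ (Finset.mem_univ w), hx, if_neg (fun h => ((hw w).1 h).2 rfl),
      add_zero, ← Finset.sum_erase_add Finset.univ (φ v) (Finset.mem_univ w)]
    congr 1
    refine Finset.sum_congr rfl fun u hu => ?_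
    by_cases hvu : M.graph.Adj v u
    · rw [if_pos ((hw u).2 ⟨hvu, (Finset.mem_erase.1 hu).1⟩)]
    · rw [if_neg (fun h => hvu ((hw u).1 h).1), h.eq_zero _ _ hvu]
  have hab := M.adj_ab.ne
  have hcd := M.adj_cd.ne
  have hac := M.ne_ac
  have had := M.ne_ad
  have hbc := M.ne_bc
  have hbd := M.ne_bd
  refine forall_of_ends ?_ ?_ ?_ ?_ fun v ha hb hc hd => ?_
  · refine key _ M.b _ (fun u => ?_) (ends_a _ _ _ _)
    simp [cutGraph_adj, hab, hac, had]
  · refine key _ M.a _ (fun u => ?_) ((ends_b _ _ _ _).trans (h.symm _ _).symm)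
    simp [cutGraph_adj, hab.symm, hbc, hbd]
  · refine key _ M.d _ (fun u => ?_) (ends_c _ _ _ _)
    simp [cutGraph_adj, hcd, hac.symm, hbc.symm]
  · refine key _ M.c _ (fun u => ?_) ((ends_d _ _ _ _).trans (h.symm _ _).symm)
    simp [cutGraph_adj, hcd.symm, had.symm, hbd.symm]
  · have h1 := h.sum_mem v
    rw [Pi.zero_apply] at h1
    rw [ends_of_ne _ _ _ _ ha hb hc hd]
    convert h1 using 2
    refine Finset.sum_congr rfl fun u _ => ?_
    split_ifs with hvu
    · rfl
    · refine (h.eq_zero _ _ fun h => hvu ?_).symm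
      simp [cutGraph_adj, h, ha, hb, hc, hd]

theorem HasValuation.exists_isValuation {α γ : A} (hσ : σ.Involutive)
    (h : M.HasValuation σ B D α (σ α) γ (σ γ)) : ∃ φ, IsValuation σ B D M.graph φ 0 := by
  classical
  obtain ⟨hα, hα', hγ, hγ', φ, h⟩ := h
  have hab := M.adj_ab.ne
  have hcd := M.adj_cd.ne
  have hac := M.ne_ac
  have had := M.ne_ad
  have hbc := M.ne_bc
  have hbd := M.ne_bd
  let ψ : M.V → M.V → A := fun u v =>
    if u = M.a ∧ v = M.b then α else if u = M.b ∧ v = M.a then σ α else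
    if u = M.c ∧ v = M.d then γ else if u = M.d ∧ v = M.c then σ γ else φ u v
  have key : ∀ v w x, (∀ u, u ≠ w → ψ v u = φ v u) → φ v w = 0 → M.ends α (σ α) γ (σ γ) v = x →
      ψ v w = x → ∑ u, ψ v u + (0 : M.V → A) v ∈ D := by
    intro v w x hψ h0 hx hw
    have h1 := h.sum_mem v
    rw [Pi.zero_apply, add_zero]
    convert h1 using 1
    rw [← Finset.sum_erase_add _ _ (Finset.mem_univ w), hx, hw,
      ← Finset.sum_erase_add Finset.univ (φ v) (Finset.mem_univ w), h0, add_zero]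
    congr 1
    exact Finset.sum_congr rfl fun u hu => hψ u (Finset.mem_erase.1 hu).1
  refine ⟨ψ, fun u v => ?_, fun u v huv => ?_, fun u v huv => ?_, ?_⟩
  · have := h.symm u v
    have := hσ α
    have := hσ γ
    dsimp only [ψ]
    grind
  · have h1 : ¬ M.cutGraph.Adj u v := fun h => huv (cutGraph_adj.1 h).1
    have := h.eq_zero u v h1
    have := M.adj_ab
    have := M.adj_ab.symm
    have := M.adj_cd
    have := M.adj_cd.symm
    dsimp only [ψ]
    grind
  · have h1 := h.mem u v
    rw [cutGraph_adj] at h1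
    dsimp only [ψ]
    grind
  · have h0 : ∀ u v, ¬ M.cutGraph.Adj u v → φ u v = 0 := h.eq_zero
    refine forall_of_ends ?_ ?_ ?_ ?_ fun v ha hb hc hd => ?_
    · refine key _ M.b _ (fun u hu => ?_) (h0 _ _ ?_) (ends_a _ _ _ _) ?_
      · simp [ψ, hu, hab, hac, had]
      · simp [cutGraph_adj]
      · simp [ψ]
    · refine key _ M.a _ (fun u hu => ?_) (h0 _ _ ?_) (ends_b _ _ _ _) ?_
      · simp [ψ, hu, hab.symm, hbc, hbd]
      · simp [cutGraph_adj]
      · simp [ψ, hab, hab.symm]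
    · refine key _ M.d _ (fun u hu => ?_) (h0 _ _ ?_) (ends_c _ _ _ _) ?_
      · simp [ψ, hu, hcd, hac.symm, hbc.symm]
      · simp [cutGraph_adj]
      · simp [ψ, hac.symm, hbc.symm]
    · refine key _ M.c _ (fun u hu => ?_) (h0 _ _ ?_) (ends_d _ _ _ _) ?_
      · simp [ψ, hu, hcd.symm, had.symm, hbd.symm]
      · simp [cutGraph_adj]
      · simp [ψ, had.symm, hbd.symm, hcd.symm]
    · have h1 := h.sum_mem v
      rw [ends_of_ne _ _ _ _ ha hb hc hd] at h1
      simpa [ψ, ha, hb, hc, hd] using h1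

end

end MarkedGraph

/-! ### Adjacency in the Petersen graph and in the dot product -/

theorem petersenGraph_adj {u v : Fin 10} : petersenGraph.Adj u v ↔
    s(u, v) ∈ ({s(0, 1), s(1, 2), s(2, 3), s(3, 4), s(4, 0), s(5, 7), s(7, 9), s(9, 6), s(6, 8),
      s(8, 5), s(0, 5), s(1, 6), s(2, 7), s(3, 8), s(4, 9)} : Finset (Sym2 (Fin 10))) := by
  simp only [petersenGraph, SimpleGraph.fromEdgeSet_adj, Finset.mem_insert, Finset.mem_singleton,
    Set.mem_insert_iff, Set.mem_singleton_iff]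
  refine ⟨And.left, fun h => ⟨h, ?_⟩⟩
  rintro rfl
  revert u
  decide

instance : DecidableRel petersenGraph.Adj := fun _ _ => decidable_of_iff' _ petersenGraph_adj

theorem sum_petersen_rest {A : Type} [AddCommMonoid A] (f : {h : Fin 10 // h ≠ 0 ∧ h ≠ 1} → A) :
    ∑ h, f h = f ⟨2, by decide⟩ + f ⟨3, by decide⟩ + f ⟨4, by decide⟩ + f ⟨5, by decide⟩ +
      f ⟨6, by decide⟩ + f ⟨7, by decide⟩ + f ⟨8, by decide⟩ + f ⟨9, by decide⟩ := by
  have h : (Finset.univ : Finset {h : Fin 10 // h ≠ 0 ∧ h ≠ 1}) =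
      {⟨2, by decide⟩, ⟨3, by decide⟩, ⟨4, by decide⟩, ⟨5, by decide⟩, ⟨6, by decide⟩,
        ⟨7, by decide⟩, ⟨8, by decide⟩, ⟨9, by decide⟩} := by decide
  rw [h]
  simp [Finset.sum_insert, add_assoc]

theorem forall_petersen_rest {p : {h : Fin 10 // h ≠ 0 ∧ h ≠ 1} → Prop} : (∀ h, p h) ↔
    p ⟨2, by decide⟩ ∧ p ⟨3, by decide⟩ ∧ p ⟨4, by decide⟩ ∧ p ⟨5, by decide⟩ ∧
      p ⟨6, by decide⟩ ∧ p ⟨7, by decide⟩ ∧ p ⟨8, by decide⟩ ∧ p ⟨9, by decide⟩ := by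
  refine ⟨fun h => ⟨h _, h _, h _, h _, h _, h _, h _, h _⟩, fun h => ?_⟩
  rintro ⟨i, hi⟩
  fin_cases i
  · exact absurd rfl hi.1
  · exact absurd rfl hi.2
  all_goals simp_all

namespace MarkedGraph

variable {M : MarkedGraph}

/-- A vertex of `M` as a vertex of the dot product. -/
def old (M : MarkedGraph) (v : M.V) : M.dotPetersen.V := Sum.inl v

/-- A vertex of the new Petersen graph as a vertex of the dot product. -/
def new (M : MarkedGraph) (i : {h : Fin 10 // h ≠ 0 ∧ h ≠ 1}) : M.dotPetersen.V := Sum.inr i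

@[simp] theorem old_inj {u v : M.V} : M.old u = M.old v ↔ u = v := Sum.inl_injective.eq_iff

@[simp] theorem new_inj {i j : {h : Fin 10 // h ≠ 0 ∧ h ≠ 1}} : M.new i = M.new j ↔ i = j :=
  Sum.inr_injective.eq_iff

@[simp] theorem old_ne_new {v : M.V} {i : {h : Fin 10 // h ≠ 0 ∧ h ≠ 1}} : M.old v ≠ M.new i :=
  Sum.inl_ne_inr

@[simp] theorem new_ne_old {v : M.V} {i : {h : Fin 10 // h ≠ 0 ∧ h ≠ 1}} : M.new i ≠ M.old v :=
  Sum.inr_ne_inl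

@[simp] theorem dotPetersen_a : M.dotPetersen.a = M.new ⟨6, by decide⟩ := rfl

@[simp] theorem dotPetersen_b : M.dotPetersen.b = M.old M.d := rfl

@[simp] theorem dotPetersen_c : M.dotPetersen.c = M.new ⟨3, by decide⟩ := rfl

@[simp] theorem dotPetersen_d : M.dotPetersen.d = M.new ⟨4, by decide⟩ := rfl

theorem forall_dotPetersen {p : M.dotPetersen.V → Prop} :
    (∀ x, p x) ↔ (∀ v, p (M.old v)) ∧ ∀ i, p (M.new i) := Sum.forall

theorem sum_dotPetersen {A : Type} [AddCommMonoid A] (f : M.dotPetersen.V → A) :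
    ∑ x, f x = ∑ v, f (M.old v) + ∑ i, f (M.new i) := Fintype.sum_sum_type _

theorem dotPetersen_adj_old_old {u v : M.V} :
    M.dotPetersen.graph.Adj (M.old u) (M.old v) ↔ M.cutGraph.Adj u v := by
  simp [old, dotPetersen, graphDotProduct, cutGraph]

theorem dotPetersen_adj_old_new {u : M.V} {h : {h : Fin 10 // h ≠ 0 ∧ h ≠ 1}} :
    M.dotPetersen.graph.Adj (M.old u) (M.new h) ↔
      (u = M.a ∧ h.1 = 4) ∨ (u = M.b ∧ h.1 = 5) ∨ (u = M.c ∧ h.1 = 2) ∨ (u = M.d ∧ h.1 = 6) := by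
  simp [old, new, dotPetersen, graphDotProduct, -Subtype.exists]

theorem dotPetersen_adj_new_old {u : M.V} {h : {h : Fin 10 // h ≠ 0 ∧ h ≠ 1}} :
    M.dotPetersen.graph.Adj (M.new h) (M.old u) ↔
      (u = M.a ∧ h.1 = 4) ∨ (u = M.b ∧ h.1 = 5) ∨ (u = M.c ∧ h.1 = 2) ∨ (u = M.d ∧ h.1 = 6) := by
  rw [SimpleGraph.adj_comm, dotPetersen_adj_old_new]

theorem dotPetersen_adj_new_new {h i : {h : Fin 10 // h ≠ 0 ∧ h ≠ 1}} :
    M.dotPetersen.graph.Adj (M.new h) (M.new i) ↔ petersenGraph.Adj h.1 i.1 := by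
  simp [new, dotPetersen, graphDotProduct]

theorem dotPetersen_cutGraph_adj_old_old {u v : M.V} :
    M.dotPetersen.cutGraph.Adj (M.old u) (M.old v) ↔ M.cutGraph.Adj u v := by
  rw [cutGraph_adj, dotPetersen_adj_old_old]
  simp

theorem dotPetersen_cutGraph_adj_old_new {u : M.V} {h : {h : Fin 10 // h ≠ 0 ∧ h ≠ 1}} :
    M.dotPetersen.cutGraph.Adj (M.old u) (M.new h) ↔
      (u = M.a ∧ h.1 = 4) ∨ (u = M.b ∧ h.1 = 5) ∨ (u = M.c ∧ h.1 = 2) := by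
  rw [cutGraph_adj, dotPetersen_adj_old_new]
  have := M.ne_ad
  have := M.ne_bd
  have := M.adj_cd.ne
  obtain ⟨h, hh⟩ := h
  simp
  grind

theorem dotPetersen_cutGraph_adj_new_old {u : M.V} {h : {h : Fin 10 // h ≠ 0 ∧ h ≠ 1}} :
    M.dotPetersen.cutGraph.Adj (M.new h) (M.old u) ↔
      (u = M.a ∧ h.1 = 4) ∨ (u = M.b ∧ h.1 = 5) ∨ (u = M.c ∧ h.1 = 2) := by
  rw [SimpleGraph.adj_comm, dotPetersen_cutGraph_adj_old_new]

theorem dotPetersen_cutGraph_adj_new_new {h i : {h : Fin 10 // h ≠ 0 ∧ h ≠ 1}} :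
    M.dotPetersen.cutGraph.Adj (M.new h) (M.new i) ↔
      petersenGraph.Adj h.1 i.1 ∧ ¬ (h.1 = 3 ∧ i.1 = 4 ∨ h.1 = 4 ∧ i.1 = 3) := by
  rw [cutGraph_adj, dotPetersen_adj_new_new]
  simp [Subtype.ext_iff]

end MarkedGraph

/-! ### Splitting a valuation of the dot product, and gluing it from its parts -/

/-- The values on the edges `23`, `27`, … of the Petersen graph without the vertices `0`, `1` and the
edge `34`, directed towards the larger end, of a valuation in which `p`, `q`, `s`, `t`, `γ`, `δ` leave
through the half-edges at `4`, `5`, `2`, `6`, `3`, `4`. -/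
structure IsPieceValuation {A : Type} [AddCommMonoid A] (σ : A → A) (B D : Set A)
    (p q s t γ δ e23 e27 e38 e49 e57 e58 e68 e69 e79 : A) : Prop where
  m23 : e23 ∈ B
  m27 : e27 ∈ B
  m38 : e38 ∈ B
  m49 : e49 ∈ B
  m57 : e57 ∈ B
  m58 : e58 ∈ B
  m68 : e68 ∈ B
  m69 : e69 ∈ B
  m79 : e79 ∈ B
  v2 : e23 + e27 + s ∈ D
  v3 : σ e23 + e38 + γ ∈ D
  v4 : e49 + p + δ ∈ D
  v5 : e57 + e58 + q ∈ D
  v6 : e68 + e69 + t ∈ D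
  v7 : σ e27 + σ e57 + e79 ∈ D
  v8 : σ e38 + σ e58 + σ e68 ∈ D
  v9 : σ e49 + σ e69 + σ e79 ∈ D

/-- The values `p`, `q`, `s`, `t`, `γ`, `δ` leaving through the half-edges at `4`, `5`, `2`, `6`, `3`,
`4` extend to a valuation of the Petersen graph without the vertices `0`, `1` and the edge `34`. -/
def PieceValuable {A : Type} [AddCommMonoid A] (σ : A → A) (B D : Set A) (p q s t γ δ : A) : Prop :=
  ∃ e23 e27 e38 e49 e57 e58 e68 e69 e79,
    IsPieceValuation σ B D p q s t γ δ e23 e27 e38 e49 e57 e58 e68 e69 e79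

namespace MarkedGraph

variable {A : Type} [AddCommMonoid A] {σ : A → A} {B D : Set A} {M : MarkedGraph}

/-- The connecting edges at `a`, `b`, `c` are cut into half-edges, with `σ`-related values on their
two sides. The edge from `d` to 6 is a selected edge of the dot product and is already cut: its half
at 6 carries `α`, its half at `d` carries `β`. -/
theorem HasValuation.restrict {α β γ δ : A} (h : M.dotPetersen.HasValuation σ B D α β γ δ) :
    ∃ α' β' γ', M.HasValuation σ B D α' β' γ' β ∧
      PieceValuable σ B D (σ α') (σ β') (σ γ') α γ δ := by
  classical
  obtain ⟨hα, hβ, hγ, hδ, φ, h⟩ := h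
  have hab := M.adj_ab.ne
  have hcd := M.adj_cd.ne
  have hac := M.ne_ac
  have had := M.ne_ad
  have hbc := M.ne_bc
  have hbd := M.ne_bd
  have h0 : ∀ (u : M.V) (i : {h : Fin 10 // h ≠ 0 ∧ h ≠ 1}), ¬ ((u = M.a ∧ i.1 = 4) ∨
      (u = M.b ∧ i.1 = 5) ∨ (u = M.c ∧ i.1 = 2)) → φ (M.old u) (M.new i) = 0 :=
    fun u i hi => h.eq_zero _ _ fun h => hi (dotPetersen_cutGraph_adj_old_new.1 h)
  have h0' : ∀ (u : M.V) (i : {h : Fin 10 // h ≠ 0 ∧ h ≠ 1}), ¬ ((u = M.a ∧ i.1 = 4) ∨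
      (u = M.b ∧ i.1 = 5) ∨ (u = M.c ∧ i.1 = 2)) → φ (M.new i) (M.old u) = 0 :=
    fun u i hi => h.eq_zero _ _ fun h => hi (dotPetersen_cutGraph_adj_new_old.1 h)
  have h0'' : ∀ (i j : {h : Fin 10 // h ≠ 0 ∧ h ≠ 1}),
      ¬ (petersenGraph.Adj i.1 j.1 ∧ ¬ (i.1 = 3 ∧ j.1 = 4 ∨ i.1 = 4 ∧ j.1 = 3)) →
      φ (M.new i) (M.new j) = 0 :=
    fun i j hi => h.eq_zero _ _ fun h => hi (dotPetersen_cutGraph_adj_new_new.1 h)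
  have hm : ∀ (i j : {h : Fin 10 // h ≠ 0 ∧ h ≠ 1}),
      (petersenGraph.Adj i.1 j.1 ∧ ¬ (i.1 = 3 ∧ j.1 = 4 ∨ i.1 = 4 ∧ j.1 = 3)) →
      φ (M.new i) (M.new j) ∈ B :=
    fun i j hi => h.mem _ _ (dotPetersen_cutGraph_adj_new_new.2 hi)
  refine ⟨φ (M.old M.a) (M.new ⟨4, by decide⟩), φ (M.old M.b) (M.new ⟨5, by decide⟩),
    φ (M.old M.c) (M.new ⟨2, by decide⟩),
    ⟨h.mem _ _ (dotPetersen_cutGraph_adj_old_new.2 (by simp)),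
    h.mem _ _ (dotPetersen_cutGraph_adj_old_new.2 (by simp)),
    h.mem _ _ (dotPetersen_cutGraph_adj_old_new.2 (by simp)), hβ,
    fun u v => φ (M.old u) (M.old v), fun u v => h.symm _ _,
    fun u v huv => h.eq_zero _ _ fun h => huv (dotPetersen_cutGraph_adj_old_old.1 h),
    fun u v huv => h.mem _ _ (dotPetersen_cutGraph_adj_old_old.2 huv), ?_⟩, ?_⟩
  · have hs : ∀ v, ∑ u, φ (M.old v) (M.old u) + (φ (M.old v) (M.new ⟨2, by decide⟩) +
        φ (M.old v) (M.new ⟨4, by decide⟩) + φ (M.old v) (M.new ⟨5, by decide⟩)) +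
        (if v = M.d then β else 0) ∈ D := by
      intro v
      have h1 := h.sum_mem (M.old v)
      rw [sum_dotPetersen, sum_petersen_rest, h0 v ⟨3, _⟩ (by simp), h0 v ⟨6, _⟩ (by simp), h0 v ⟨7, _⟩ (by simp),
        h0 v ⟨8, _⟩ (by simp), h0 v ⟨9, _⟩ (by simp)] at h1
      simpa [ends] using h1
    refine forall_of_ends ?_ ?_ ?_ ?_ fun v ha hb hc hd => ?_
    · have := hs M.a
      rw [h0 _ ⟨2, _⟩ (by simp [hac]), h0 _ ⟨5, _⟩ (by simp [hab])] at this
      simpa [ends_a, had] using this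
    · have := hs M.b
      rw [h0 _ ⟨2, _⟩ (by simp [hbc]), h0 _ ⟨4, _⟩ (by simp [hab.symm])] at this
      simpa [ends_b, hbd] using this
    · have := hs M.c
      rw [h0 _ ⟨4, _⟩ (by simp [hac.symm]), h0 _ ⟨5, _⟩ (by simp [hbc.symm])] at this
      simpa [ends_c, hcd] using this
    · have := hs M.d
      rw [h0 _ ⟨2, _⟩ (by simp [hcd.symm]), h0 _ ⟨4, _⟩ (by simp [had.symm]),
        h0 _ ⟨5, _⟩ (by simp [hbd.symm])] at this
      simpa [ends_d] using this
    · have := hs v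
      rw [h0 _ ⟨2, _⟩ (by simp [hc]), h0 _ ⟨4, _⟩ (by simp [ha]),
        h0 _ ⟨5, _⟩ (by simp [hb])] at this
      simpa [ends_of_ne _ _ _ _ ha hb hc hd, hd] using this
  -- Extension by zero to all of `Fin 10`, so that vanishing and membership become decidable
  -- statements about numerals.
  · let w : Fin 10 → Fin 10 → A := fun i j =>
      if hi : i ≠ 0 ∧ i ≠ 1 then if hj : j ≠ 0 ∧ j ≠ 1 then φ (M.new ⟨i, hi⟩) (M.new ⟨j, hj⟩)
      else 0 else 0
    have hw : ∀ i j (hi : i ≠ 0 ∧ i ≠ 1) (hj : j ≠ 0 ∧ j ≠ 1),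
        φ (M.new ⟨i, hi⟩) (M.new ⟨j, hj⟩) = w i j := by
      intro i j hi hj
      simp only [w, dif_pos hi, dif_pos hj]
    have w0 : ∀ i j, ¬ (petersenGraph.Adj i j ∧ ¬ (i = 3 ∧ j = 4 ∨ i = 4 ∧ j = 3)) → w i j = 0 := by
      intro i j hij
      dsimp only [w]
      split_ifs
      · exact h0'' _ _ hij
      · rfl
      · rfl
    have ws : ∀ i j, i ≠ 0 ∧ i ≠ 1 → j ≠ 0 ∧ j ≠ 1 → w j i = σ (w i j) := by
      intro i j hi hj
      rw [← hw i j hi hj, ← hw j i hj hi]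
      exact h.symm _ _
    have wm : ∀ i j, i ≠ 0 ∧ i ≠ 1 → j ≠ 0 ∧ j ≠ 1 →
        (petersenGraph.Adj i j ∧ ¬ (i = 3 ∧ j = 4 ∨ i = 4 ∧ j = 3)) → w i j ∈ B := by
      intro i j hi hj hij
      rw [← hw i j hi hj]
      exact hm _ _ hij
    have hv : ∀ (i) (hi : i ≠ 0 ∧ i ≠ 1), ∑ u, φ (M.new ⟨i, hi⟩) (M.old u) +
        (w i 2 + w i 3 + w i 4 + w i 5 + w i 6 + w i 7 + w i 8 + w i 9) +
        ((if i = 6 then α else 0) + (if i = 3 then γ else 0) + (if i = 4 then δ else 0)) ∈ D := by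
      intro i hi
      have h1 := h.sum_mem (M.new ⟨i, hi⟩)
      rw [sum_dotPetersen, sum_petersen_rest] at h1
      simpa [ends, hw, add_assoc] using h1
    have hc : ∀ (i) (hi : i ≠ 0 ∧ i ≠ 1) u, ((i = 4 ∧ u = M.a) ∨ (i = 5 ∧ u = M.b) ∨
        (i = 2 ∧ u = M.c)) → ∑ u, φ (M.new ⟨i, hi⟩) (M.old u) =
          σ (φ (M.old u) (M.new ⟨i, hi⟩)) := by
      intro i hi u hu
      rw [← h.symm]
      refine Finset.sum_eq_single _ (fun v _ hv => h0' _ _ ?_) (by simp)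
      rcases hu with ⟨rfl, rfl⟩ | ⟨rfl, rfl⟩ | ⟨rfl, rfl⟩ <;> simp [hv]
    have hc0 : ∀ (i) (hi : i ≠ 0 ∧ i ≠ 1), i ≠ 4 → i ≠ 5 → i ≠ 2 →
        ∑ u, φ (M.new ⟨i, hi⟩) (M.old u) = 0 := by
      intro i hi h4 h5 h2
      exact Finset.sum_eq_zero fun v _ => h0' _ _ (by simp [h4, h5, h2])
    refine ⟨w 2 3, w 2 7, w 3 8, w 4 9, w 5 7, w 5 8, w 6 8, w 6 9, w 7 9, ?_⟩
    constructor
    iterate 9 exact wm _ _ (by decide) (by decide) (by decide)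
    · have := hv 2 (by decide)
      rw [hc 2 _ M.c (by simp), w0 2 2 (by decide), w0 2 4 (by decide), w0 2 5 (by decide),
        w0 2 6 (by decide), w0 2 8 (by decide), w0 2 9 (by decide)] at this
      simp at this
      convert this using 1
      abel
    · have := hv 3 (by decide)
      rw [hc0 3 _ (by decide) (by decide) (by decide), w0 3 3 (by decide), w0 3 4 (by decide),
        w0 3 5 (by decide), w0 3 6 (by decide), w0 3 7 (by decide), w0 3 9 (by decide),
        ws 2 3 (by decide) (by decide)] at this
      simp at this
      convert this using 1
    · have := hv 4 (by decide)
      rw [hc 4 _ M.a (by simp), w0 4 2 (by decide), w0 4 3 (by decide), w0 4 4 (by decide),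
        w0 4 5 (by decide), w0 4 6 (by decide), w0 4 7 (by decide), w0 4 8 (by decide)] at this
      simp at this
      convert this using 1
      abel
    · have := hv 5 (by decide)
      rw [hc 5 _ M.b (by simp), w0 5 2 (by decide), w0 5 3 (by decide), w0 5 4 (by decide),
        w0 5 5 (by decide), w0 5 6 (by decide), w0 5 9 (by decide)] at this
      simp at this
      convert this using 1
      abel
    · have := hv 6 (by decide)
      rw [hc0 6 _ (by decide) (by decide) (by decide), w0 6 2 (by decide), w0 6 3 (by decide),
        w0 6 4 (by decide), w0 6 5 (by decide), w0 6 6 (by decide), w0 6 7 (by decide)] at this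
      simp at this
      convert this using 1
    · have := hv 7 (by decide)
      rw [hc0 7 _ (by decide) (by decide) (by decide), w0 7 3 (by decide),
        w0 7 4 (by decide), w0 7 6 (by decide), w0 7 7 (by decide), w0 7 8 (by decide),
        ws 2 7 (by decide) (by decide), ws 5 7 (by decide) (by decide)] at this
      simp at this
      convert this using 1
    · have := hv 8 (by decide)
      rw [hc0 8 _ (by decide) (by decide) (by decide), w0 8 2 (by decide),
        w0 8 4 (by decide), w0 8 7 (by decide), w0 8 8 (by decide), w0 8 9 (by decide),
        ws 3 8 (by decide) (by decide), ws 5 8 (by decide) (by decide),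
        ws 6 8 (by decide) (by decide)] at this
      simp at this
      convert this using 1
    · have := hv 9 (by decide)
      rw [hc0 9 _ (by decide) (by decide) (by decide), w0 9 2 (by decide), w0 9 3 (by decide),
        w0 9 5 (by decide), w0 9 8 (by decide), w0 9 9 (by decide),
        ws 4 9 (by decide) (by decide), ws 6 9 (by decide) (by decide),
        ws 7 9 (by decide) (by decide)] at this
      simp at this
      convert this using 1

end MarkedGraph

/-- The arc values of the Petersen graph without the vertices `0`, `1` and the edge `34`. -/
def pieceArc {A : Type} [AddCommMonoid A] (σ : A → A)
    (e23 e27 e38 e49 e57 e58 e68 e69 e79 : A) : Fin 10 → Fin 10 → A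
  | 2, 3 => e23 | 2, 7 => e27 | 3, 8 => e38 | 4, 9 => e49 | 5, 7 => e57 | 5, 8 => e58
  | 6, 8 => e68 | 6, 9 => e69 | 7, 9 => e79
  | 3, 2 => σ e23 | 7, 2 => σ e27 | 8, 3 => σ e38 | 9, 4 => σ e49 | 7, 5 => σ e57 | 8, 5 => σ e58
  | 8, 6 => σ e68 | 9, 6 => σ e69 | 9, 7 => σ e79
  | _, _ => 0

namespace MarkedGraph

variable {A : Type} [AddCommMonoid A] {σ : A → A} {B D : Set A} {M : MarkedGraph}

open scoped Classical in
/-- The arc values of the dot product given by those of its two parts. -/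
noncomputable def glue (σ : A → A) (M : MarkedGraph) (φ : M.V → M.V → A)
    (w : Fin 10 → Fin 10 → A) (α β γ : A) : M.dotPetersen.V → M.dotPetersen.V → A
  | Sum.inl u, Sum.inl v => φ u v
  | Sum.inl u, Sum.inr i => if u = M.a ∧ i.1 = 4 then α else if u = M.b ∧ i.1 = 5 then β else
      if u = M.c ∧ i.1 = 2 then γ else 0
  | Sum.inr i, Sum.inl u => if u = M.a ∧ i.1 = 4 then σ α else if u = M.b ∧ i.1 = 5 then σ β else
      if u = M.c ∧ i.1 = 2 then σ γ else 0
  | Sum.inr i, Sum.inr j => w i.1 j.1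

section

variable {φ : M.V → M.V → A} {w : Fin 10 → Fin 10 → A} {α β γ : A}

@[simp] theorem glue_old_old (u v : M.V) : M.glue σ φ w α β γ (M.old u) (M.old v) = φ u v := rfl

open scoped Classical in
theorem glue_old_new (u : M.V) (i) : M.glue σ φ w α β γ (M.old u) (M.new i) =
    if u = M.a ∧ i.1 = 4 then α else if u = M.b ∧ i.1 = 5 then β else
      if u = M.c ∧ i.1 = 2 then γ else 0 := rfl

open scoped Classical in
theorem glue_new_old (u : M.V) (i) : M.glue σ φ w α β γ (M.new i) (M.old u) =
    if u = M.a ∧ i.1 = 4 then σ α else if u = M.b ∧ i.1 = 5 then σ β else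
      if u = M.c ∧ i.1 = 2 then σ γ else 0 := rfl

@[simp] theorem glue_new_new (i j) : M.glue σ φ w α β γ (M.new i) (M.new j) = w i.1 j.1 := rfl

end

/-- Converse of `HasValuation.restrict`. The value `β` at `d` in the old graph stays on its
half-edge, now a half of the newly selected edge; `α` on the other half is unrelated to it at this
stage. -/
theorem HasValuation.extend {α β γ δ α' β' γ' : A} (hσ : σ.Involutive) (hσ0 : σ 0 = 0)
    (hB : ∀ x ∈ B, σ x ∈ B) (hα : α ∈ B) (hγ : γ ∈ B) (hδ : δ ∈ B)
    (h : M.HasValuation σ B D α' β' γ' β)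
    (hp : PieceValuable σ B D (σ α') (σ β') (σ γ') α γ δ) :
    M.dotPetersen.HasValuation σ B D α β γ δ := by
  classical
  obtain ⟨hα', hβ', hγ', hβ, φ, h⟩ := h
  obtain ⟨e23, e27, e38, e49, e57, e58, e68, e69, e79, hp⟩ := hp
  have hab := M.adj_ab.ne
  have hcd := M.adj_cd.ne
  have hac := M.ne_ac
  have had := M.ne_ad
  have hbc := M.ne_bc
  have hbd := M.ne_bd
  set w := pieceArc σ e23 e27 e38 e49 e57 e58 e68 e69 e79 with hw
  refine ⟨hα, hβ, hγ, hδ, M.glue σ φ w α' β' γ', ?_, ?_, ?_, ?_⟩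
  · simp only [forall_dotPetersen]
    refine ⟨fun u => ⟨h.symm u, fun i => ?_⟩, fun i => ⟨fun u => ?_, fun j => ?_⟩⟩
    · rw [glue_old_new, glue_new_old]
      split_ifs <;> simp [hσ0]
    · rw [glue_old_new, glue_new_old]
      split_ifs <;> simp [hσ0, hσ _]
    · rw [glue_new_new, glue_new_new]
      revert i j
      simp only [forall_petersen_rest]
      simp [hw, pieceArc, hσ0, hσ _]
  · simp only [forall_dotPetersen]
    refine ⟨fun u => ⟨fun v => ?_, fun i => ?_⟩, fun i => ⟨fun u => ?_, fun j => ?_⟩⟩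
    · rw [dotPetersen_cutGraph_adj_old_old]
      exact h.eq_zero u v
    · rw [dotPetersen_cutGraph_adj_old_new, glue_old_new]
      intro hi
      simp only [not_or] at hi
      simp [hi]
    · rw [dotPetersen_cutGraph_adj_new_old, glue_new_old]
      intro hi
      simp only [not_or] at hi
      simp [hi]
    · rw [dotPetersen_cutGraph_adj_new_new, glue_new_new]
      revert i j
      simp only [forall_petersen_rest]
      simp [hw, pieceArc, petersenGraph_adj]
  · simp only [forall_dotPetersen]
    refine ⟨fun u => ⟨fun v => ?_, fun i => ?_⟩, fun i => ⟨fun u => ?_, fun j => ?_⟩⟩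
    · rw [dotPetersen_cutGraph_adj_old_old]
      exact h.mem u v
    · rw [dotPetersen_cutGraph_adj_old_new, glue_old_new]
      grind
    · rw [dotPetersen_cutGraph_adj_new_old, glue_new_old]
      grind
    · rw [dotPetersen_cutGraph_adj_new_new, glue_new_new]
      obtain ⟨m23, m27, m38, m49, m57, m58, m68, m69, m79⟩ := hp
      revert i j
      simp only [forall_petersen_rest]
      simp [pieceArc, petersenGraph_adj, *]
  · simp only [forall_dotPetersen, sum_dotPetersen]
    refine ⟨?_, ?_⟩
    · refine forall_of_ends ?_ ?_ ?_ ?_ fun v ha hb hc hd => ?_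
      · have := h.sum_mem M.a
        rw [ends_a] at this
        simpa [sum_petersen_rest, glue_old_new, ends, hab, hac, had] using this
      · have := h.sum_mem M.b
        rw [ends_b] at this
        simpa [sum_petersen_rest, glue_old_new, ends, hab.symm, hbc, hbd] using this
      · have := h.sum_mem M.c
        rw [ends_c] at this
        simpa [sum_petersen_rest, glue_old_new, ends, hac.symm, hcd, hbc.symm] using this
      · have := h.sum_mem M.d
        rw [ends_d] at this
        simpa [sum_petersen_rest, glue_old_new, ends, had.symm, hcd.symm, hbd.symm] using this
      · have := h.sum_mem v
        rw [ends_of_ne _ _ _ _ ha hb hc hd] at this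
        simpa [sum_petersen_rest, glue_old_new, ends, ha, hb, hc, hd] using this
    · obtain ⟨-, -, -, -, -, -, -, -, -, v2, v3, v4, v5, v6, v7, v8, v9⟩ := hp
      simp only [forall_petersen_rest]
      simp only [sum_petersen_rest, glue_new_old, glue_new_new, ends]
      simp [hw, pieceArc]
      refine ⟨?_, v3, ?_, ?_, v6, v7, v8, v9⟩
      · rwa [add_comm]
      · rwa [add_comm (σ α')]
      · rwa [add_comm]

end MarkedGraph

/-! ### The first Petersen graph of the chain -/

theorem markedPetersen_ends {A : Type} [AddCommMonoid A] (α β γ δ : A) :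
    markedPetersen.ends α β γ δ = ![α, β, 0, δ, γ, 0, 0, 0, 0, 0] := by
  have h : ∀ i : Fin 10, i ≠ 0 → i ≠ 1 → i ≠ 4 → i ≠ 3 → markedPetersen.ends α β γ δ i = 0 :=
    fun i => MarkedGraph.ends_of_ne (M := markedPetersen) (v := i) α β γ δ
  refine funext fun (i : Fin 10) => ?_
  fin_cases i
  · exact MarkedGraph.ends_a _ _ _ _
  · exact MarkedGraph.ends_b _ _ _ _
  · exact h 2 (by decide) (by decide) (by decide) (by decide)
  · exact MarkedGraph.ends_d _ _ _ _
  · exact MarkedGraph.ends_c _ _ _ _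
  · exact h 5 (by decide) (by decide) (by decide) (by decide)
  · exact h 6 (by decide) (by decide) (by decide) (by decide)
  · exact h 7 (by decide) (by decide) (by decide) (by decide)
  · exact h 8 (by decide) (by decide) (by decide) (by decide)
  · exact h 9 (by decide) (by decide) (by decide) (by decide)

theorem hasValuation_markedPetersen_iff {A : Type} [AddCommMonoid A] {σ : A → A} {B D : Set A}
    {α β γ δ : A} : markedPetersen.HasValuation σ B D α β γ δ ↔
      α ∈ B ∧ β ∈ B ∧ γ ∈ B ∧ δ ∈ B ∧ ∃ φ : Fin 10 → Fin 10 → A,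
        IsValuation σ B D (petersenGraph.deleteEdges {s(0, 1), s(4, 3)}) φ
          ![α, β, 0, δ, γ, 0, 0, 0, 0, 0] := by
  rw [← markedPetersen_ends]
  rfl

theorem sum_fin_ten {A : Type} [AddCommMonoid A] (f : Fin 10 → A) :
    ∑ i, f i = f 0 + f 1 + f 2 + f 3 + f 4 + f 5 + f 6 + f 7 + f 8 + f 9 := by
  simp [Fin.sum_univ_succ, add_assoc]

theorem petersen_deleteEdges_adj {u v : Fin 10} :
    (petersenGraph.deleteEdges {s(0, 1), s(4, 3)}).Adj u v ↔
      petersenGraph.Adj u v ∧ s(u, v) ∉ ({s(0, 1), s(4, 3)} : Finset (Sym2 (Fin 10))) := by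
  simp [SimpleGraph.deleteEdges_adj]

/-- The first Petersen graph is the same piece closed by the vertices 0 and 1, and `p`, `q`, `s`,
`t` are the values on the arcs into them. Here `c` = 4 and `d` = 3, in the opposite order to the
later copies, whence `δ` before `γ` in the piece. -/
theorem exists_of_hasValuation_markedPetersen {A : Type} [AddCommMonoid A] {σ : A → A} {B D : Set A}
    {α β γ δ : A} (h : markedPetersen.HasValuation σ B D α β γ δ) :
    ∃ p ∈ B, ∃ q ∈ B, ∃ s ∈ B, ∃ t ∈ B, σ p + σ q + α ∈ D ∧ σ s + σ t + β ∈ D ∧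
      PieceValuable σ B D p q s t δ γ := by
  obtain ⟨hα, hβ, hγ, hδ, φ, h⟩ := hasValuation_markedPetersen_iff.1 h
  have h0 : ∀ i j, ¬ (petersenGraph.Adj i j ∧
      s(i, j) ∉ ({s(0, 1), s(4, 3)} : Finset (Sym2 (Fin 10)))) → φ i j = 0 :=
    fun i j hij => h.eq_zero _ _ fun h => hij (petersen_deleteEdges_adj.1 h)
  have hm : ∀ i j, (petersenGraph.Adj i j ∧
      s(i, j) ∉ ({s(0, 1), s(4, 3)} : Finset (Sym2 (Fin 10)))) → φ i j ∈ B :=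
    fun i j hij => h.mem _ _ (petersen_deleteEdges_adj.2 hij)
  have hv := h.sum_mem
  have hs := h.symm
  simp only [sum_fin_ten] at hv
  have v0 := hv 0
  rw [h0 0 0 (by decide), h0 0 1 (by decide), h0 0 2 (by decide), h0 0 3 (by decide),
    h0 0 6 (by decide), h0 0 7 (by decide), h0 0 8 (by decide), h0 0 9 (by decide),
    hs 4 0, hs 5 0] at v0
  have v1 := hv 1
  rw [h0 1 0 (by decide), h0 1 1 (by decide), h0 1 3 (by decide), h0 1 4 (by decide),
    h0 1 5 (by decide), h0 1 7 (by decide), h0 1 8 (by decide), h0 1 9 (by decide),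
    hs 2 1, hs 6 1] at v1
  have v2 := hv 2
  rw [h0 2 0 (by decide), h0 2 2 (by decide), h0 2 4 (by decide), h0 2 5 (by decide),
    h0 2 6 (by decide), h0 2 8 (by decide), h0 2 9 (by decide)] at v2
  have v3 := hv 3
  rw [h0 3 0 (by decide), h0 3 1 (by decide), h0 3 3 (by decide), h0 3 4 (by decide),
    h0 3 5 (by decide), h0 3 6 (by decide), h0 3 7 (by decide), h0 3 9 (by decide), hs 2 3] at v3
  have v4 := hv 4
  rw [h0 4 1 (by decide), h0 4 2 (by decide), h0 4 3 (by decide), h0 4 4 (by decide),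
    h0 4 5 (by decide), h0 4 6 (by decide), h0 4 7 (by decide), h0 4 8 (by decide)] at v4
  have v5 := hv 5
  rw [h0 5 1 (by decide), h0 5 2 (by decide), h0 5 3 (by decide), h0 5 4 (by decide),
    h0 5 5 (by decide), h0 5 6 (by decide), h0 5 9 (by decide)] at v5
  have v6 := hv 6
  rw [h0 6 0 (by decide), h0 6 2 (by decide), h0 6 3 (by decide), h0 6 4 (by decide),
    h0 6 5 (by decide), h0 6 6 (by decide), h0 6 7 (by decide)] at v6
  have v7 := hv 7
  rw [h0 7 0 (by decide), h0 7 1 (by decide), h0 7 3 (by decide), h0 7 4 (by decide),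
    h0 7 6 (by decide), h0 7 7 (by decide), h0 7 8 (by decide), hs 2 7, hs 5 7] at v7
  have v8 := hv 8
  rw [h0 8 0 (by decide), h0 8 1 (by decide), h0 8 2 (by decide), h0 8 4 (by decide),
    h0 8 7 (by decide), h0 8 8 (by decide), h0 8 9 (by decide), hs 3 8, hs 5 8, hs 6 8] at v8
  have v9 := hv 9
  rw [h0 9 0 (by decide), h0 9 1 (by decide), h0 9 2 (by decide), h0 9 3 (by decide),
    h0 9 5 (by decide), h0 9 8 (by decide), h0 9 9 (by decide), hs 4 9, hs 6 9, hs 7 9] at v9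
  refine ⟨φ 4 0, hm _ _ (by decide), φ 5 0, hm _ _ (by decide), φ 2 1, hm _ _ (by decide), φ 6 1,
    hm _ _ (by decide), by simpa using v0, by simpa using v1,
    φ 2 3, φ 2 7, φ 3 8, φ 4 9, φ 5 7, φ 5 8, φ 6 8, φ 6 9, φ 7 9, ?_⟩
  constructor
  iterate 9 exact hm _ _ (by decide)
  all_goals simp only [Matrix.cons_val, zero_add, add_zero] at *
  · convert v2 using 1; abel
  · convert v3 using 1
  · convert v4 using 1; abel
  · convert v5 using 1; abel
  · convert v6 using 1; abel
  · convert v7 using 1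
  · convert v8 using 1
  · convert v9 using 1

/-- The arc values of the Petersen graph without the edges `01`, `34`, with the values `p`, `q`, `s`,
`t` on the arcs `40`, `50`, `21`, `61`, and `w` elsewhere. -/
def petersenArc {A : Type} [AddCommMonoid A] (σ : A → A) (p q s t : A)
    (w : Fin 10 → Fin 10 → A) : Fin 10 → Fin 10 → A
  | 4, 0 => p | 5, 0 => q | 2, 1 => s | 6, 1 => t
  | 0, 4 => σ p | 0, 5 => σ q | 1, 2 => σ s | 1, 6 => σ t
  | i, j => w i j

theorem hasValuation_markedPetersen {A : Type} [AddCommMonoid A] {σ : A → A} {B D : Set A}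
    {α β γ δ p q s t : A} (hσ : σ.Involutive) (hσ0 : σ 0 = 0) (hB : ∀ x ∈ B, σ x ∈ B)
    (hα : α ∈ B) (hβ : β ∈ B) (hγ : γ ∈ B) (hδ : δ ∈ B)
    (hp : p ∈ B) (hq : q ∈ B) (hs : s ∈ B) (ht : t ∈ B)
    (h0 : σ p + σ q + α ∈ D) (h1 : σ s + σ t + β ∈ D) (h : PieceValuable σ B D p q s t δ γ) :
    markedPetersen.HasValuation σ B D α β γ δ := by
  rw [hasValuation_markedPetersen_iff]
  obtain ⟨e23, e27, e38, e49, e57, e58, e68, e69, e79, m23, m27, m38, m49, m57, m58, m68, m69, m79,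
    v2, v3, v4, v5, v6, v7, v8, v9⟩ := h
  refine ⟨hα, hβ, hγ, hδ, petersenArc σ p q s t (pieceArc σ e23 e27 e38 e49 e57 e58 e68 e69 e79),
    ?_, ?_, ?_, ?_⟩
  · intro i j
    fin_cases i <;> fin_cases j <;> first | exact hσ0.symm | rfl | exact (hσ _).symm
  · simp only [petersen_deleteEdges_adj]
    have : ∀ i j, petersenArc σ p q s t (pieceArc σ e23 e27 e38 e49 e57 e58 e68 e69 e79) i j = 0 ∨
       (petersenGraph.Adj i j ∧ s(i, j) ∉ ({s(0, 1), s(4, 3)} : Finset (Sym2 (Fin 10)))) := by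
      intro i j
      fin_cases i <;> fin_cases j <;> first | exact Or.inl rfl | exact Or.inr (by decide)
    exact fun i j => (this i j).resolve_right
  · simp only [petersen_deleteEdges_adj]
    have : ∀ i j, petersenArc σ p q s t (pieceArc σ e23 e27 e38 e49 e57 e58 e68 e69 e79) i j ∈ B ∨
       ¬ (petersenGraph.Adj i j ∧ s(i, j) ∉ ({s(0, 1), s(4, 3)} : Finset (Sym2 (Fin 10)))) := by
      intro i j
      fin_cases i <;> fin_cases j <;>
        first
        | exact Or.inr (by decide)
        | (left; simp only [petersenArc, pieceArc]; first | assumption | (apply hB; assumption))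
    exact fun i j h => (this i j).resolve_right (not_not_intro h)
  · simp only [sum_fin_ten]
    intro i
    fin_cases i
    · change 0 + 0 + 0 + 0 + σ p + σ q + 0 + 0 + 0 + 0 + α ∈ D
      convert h0 using 1
      simp only [zero_add, add_zero]
      try abel
    · change 0 + 0 + σ s + 0 + 0 + 0 + σ t + 0 + 0 + 0 + β ∈ D
      convert h1 using 1
      simp only [zero_add, add_zero]
      try abel
    · change 0 + s + 0 + e23 + 0 + 0 + 0 + e27 + 0 + 0 + 0 ∈ D
      convert v2 using 1
      simp only [zero_add, add_zero]
      try abel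
    · change 0 + 0 + σ e23 + 0 + 0 + 0 + 0 + 0 + e38 + 0 + δ ∈ D
      convert v3 using 1
      simp only [zero_add, add_zero]
      try abel
    · change p + 0 + 0 + 0 + 0 + 0 + 0 + 0 + 0 + e49 + γ ∈ D
      convert v4 using 1
      simp only [add_zero]
      try abel
    · change q + 0 + 0 + 0 + 0 + 0 + 0 + e57 + e58 + 0 + 0 ∈ D
      convert v5 using 1
      simp only [add_zero]
      try abel
    · change 0 + t + 0 + 0 + 0 + 0 + 0 + 0 + e68 + e69 + 0 ∈ D
      convert v6 using 1
      simp only [zero_add, add_zero]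
      try abel
    · change 0 + 0 + σ e27 + 0 + 0 + σ e57 + 0 + 0 + 0 + e79 + 0 ∈ D
      convert v7 using 1
      simp only [zero_add, add_zero]
      try abel
    · change 0 + 0 + 0 + σ e38 + 0 + σ e58 + σ e68 + 0 + 0 + 0 + 0 ∈ D
      convert v8 using 1
      simp only [zero_add, add_zero]
      try abel
    · change 0 + 0 + 0 + 0 + σ e49 + 0 + σ e69 + σ e79 + 0 + 0 + 0 ∈ D
      convert v9 using 1
      simp only [zero_add, add_zero]
      try abel

/-! ### Degrees, flows and colourings as valuations -/

/-- Every `3`-element neighbourhood consists of three different vertices. -/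
theorem IsCubic.exists_neighbors {V : Type} {G : SimpleGraph V} (h : IsCubic G) (v : V) :
    ∃ x y z, x ≠ y ∧ x ≠ z ∧ y ≠ z ∧ ∀ u, G.Adj v u ↔ u = x ∨ u = y ∨ u = z := by
  obtain ⟨x, y, z, hxy, hxz, hyz, h⟩ := Set.encard_eq_three.1 (h v)
  exact ⟨x, y, z, hxy, hxz, hyz, fun u => by rw [← SimpleGraph.mem_neighborSet, h]; simp⟩

theorem sum_eq_of_neighbors {V A : Type} [Fintype V] [AddCommMonoid A] {G : SimpleGraph V}
    {v x y z : V} (hxy : x ≠ y) (hxz : x ≠ z) (hyz : y ≠ z)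
    (h : ∀ u, G.Adj v u ↔ u = x ∨ u = y ∨ u = z) {f : V → A} (hf : ∀ u, ¬ G.Adj v u → f u = 0) :
    ∑ u, f u = f x + f y + f z := by
  classical
  rw [← Finset.sum_subset (Finset.subset_univ {x, y, z}), Finset.sum_insert (by simp [hxy, hxz]),
    Finset.sum_pair hyz, add_assoc]
  intro u _ hu
  refine hf u fun hvu => hu ?_
  simpa using (h u).1 hvu

/-- With the value 1 on every arc, the sum at a vertex counts its neighbours. -/
theorem isCubic_of_isValuation {V : Type} [Fintype V] {G : SimpleGraph V} {φ : V → V → ℕ}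
    (h : IsValuation id {1} {3} G φ 0) : IsCubic G := by
  classical
  intro v
  have h1 := h.sum_mem v
  have h2 : ∀ u, φ v u = if G.Adj v u then 1 else 0 := by
    intro u
    split_ifs with hu
    · exact h.mem _ _ hu
    · exact h.eq_zero _ _ hu
  simp only [h2, Pi.zero_apply, add_zero, Set.mem_singleton_iff, Finset.sum_boole] at h1
  rw [← Set.coe_toFinset (G.neighborSet v), Set.encard_coe_eq_coe_finsetCard]
  norm_cast
  rw [← h1]
  simp only [Nat.cast_id]
  congr 1
  ext u
  simp

open scoped Classical in
/-- The circular flow given by a real-valued flow. -/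
theorem nonempty_circularNowhereZeroFlow {V : Type} [Fintype V] {G : SimpleGraph V} {r : ℝ}
    {φ : V → V → ℝ} (h : IsValuation Neg.neg {x | 1 ≤ |x| ∧ |x| ≤ r - 1} {0} G φ 0) :
    Nonempty (CircularNowhereZeroFlow G r) := by
  have habs : ∀ u v, |φ u v| = |φ v u| := fun u v => by rw [h.symm u v]; exact (abs_neg _).symm
  refine ⟨⟨fun u v => 0 < φ u v, fun u v => ?_, fun u v huv => ?_,
    Sym2.lift ⟨fun u v => |φ u v|, habs⟩, ?_, fun v => ?_⟩⟩
  · have h1 := h.eq_zero u v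
    have h2 := h.mem u v
    have h3 : φ v u = -φ u v := h.symm u v
    refine ⟨fun huv => ?_, fun huv => ?_⟩
    · have h4 : φ u v ≠ 0 := by
        intro h0
        have := (h2 huv).1
        rw [h0, abs_zero] at this
        linarith
      rw [h3, neg_pos]
      exact h4.symm.lt_or_gt
    · by_contra hn
      rw [h3, h1 hn] at huv
      simp at huv
  · have h3 : φ v u = -φ u v := h.symm u v
    rw [h3]
    linarith
  · intro e
    induction e with
    | _ u v => exact fun huv => h.mem u v huv
  · have h1 : ∑ u, φ v u + 0 = 0 := h.sum_mem v
    rw [add_zero] at h1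
    rw [← sub_eq_zero, ← Finset.sum_sub_distrib, ← neg_eq_zero, ← Finset.sum_neg_distrib]
    refine Eq.trans ?_ h1
    refine Finset.sum_congr rfl fun u _ => ?_
    have h3 : φ u v = -φ v u := h.symm v u
    simp only [Sym2.lift_mk, h3]
    split_ifs with h4 h5 h5
    · linarith
    · rw [abs_of_pos h4]
      ring
    · rw [abs_of_pos h5]
      ring
    · linarith

open scoped Classical in
/-- A circular flow of a cubic graph, after subtracting `r / 2` from the values along the
orientation. -/
theorem CircularNowhereZeroFlow.exists_isValuation {V : Type} [Fintype V] {G : SimpleGraph V} {r : ℝ}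
    (F : CircularNowhereZeroFlow G r) (hG : IsCubic G) :
    ∃ φ, IsValuation Neg.neg {x | |x| ≤ r / 2 - 1} {r / 2, -(r / 2)} G φ 0 := by
  have hb : ∀ u v, G.Adj u v → 1 ≤ F.f s(u, v) ∧ F.f s(u, v) ≤ r - 1 :=
    fun u v huv => F.mem_Icc s(u, v) huv
  refine ⟨fun u v => if F.dir u v then F.f s(u, v) - r / 2 else
    if F.dir v u then r / 2 - F.f s(u, v) else 0, fun u v => ?_, fun u v huv => ?_,
    fun u v huv => ?_, fun v => ?_⟩
  · have := F.asymm u v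
    rw [Sym2.eq_swap]
    split_ifs <;> first | (exfalso; tauto) | (simp)
  · have := (F.adj_iff u v).not.1 huv
    rw [not_or] at this
    simp [this]
  · obtain ⟨h1, h2⟩ := hb u v huv
    have := (F.adj_iff u v).1 huv
    simp only [Set.mem_ofPred_eq, abs_le]
    split_ifs
    · constructor <;> linarith
    · constructor <;> linarith
    · tauto
  · obtain ⟨x, y, z, hxy, hxz, hyz, hv⟩ := hG.exists_neighbors v
    have hc := F.conservation v
    have hn : ∀ u, ¬ G.Adj v u → ¬ F.dir u v ∧ ¬ F.dir v u := by
      intro u hu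
      have := (F.adj_iff v u).not.1 hu
      tauto
    rw [sum_eq_of_neighbors hxy hxz hyz hv (fun u hu => by simp [hn u hu]),
      sum_eq_of_neighbors hxy hxz hyz hv (fun u hu => by simp [hn u hu])] at hc
    rw [sum_eq_of_neighbors hxy hxz hyz hv (fun u hu => by simp [hn u hu])]
    simp only [Sym2.eq_swap (a := x) (b := v), Sym2.eq_swap (a := y) (b := v),
      Sym2.eq_swap (a := z) (b := v)] at hc
    have hx := (hv x).2 (by simp)
    have hy := (hv y).2 (by simp)
    have hz := (hv z).2 (by simp)
    have hx1 := (hb v x hx).1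
    have hy1 := (hb v y hy).1
    have hz1 := (hb v z hz).1
    have key : ∀ u, G.Adj v u → F.dir v u ∧ ¬ F.dir u v ∨ F.dir u v ∧ ¬ F.dir v u := by
      intro u hu
      have h1 := (F.adj_iff v u).1 hu
      have h2 := F.asymm v u
      tauto
    simp only [Pi.zero_apply, add_zero, Set.mem_insert_iff, Set.mem_singleton_iff]
    -- Three edges all leaving or all entering `v` contradict conservation, as the values are at
    -- least 1. Otherwise one direction occurs twice, and the shifts by `r / 2` leave one net copy
    -- of `±(r / 2)`.
    rcases key x hx with ⟨a1, a2⟩ | ⟨a1, a2⟩ <;> rcases key y hy with ⟨b1, b2⟩ | ⟨b1, b2⟩ <;>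
      rcases key z hz with ⟨c1, c2⟩ | ⟨c1, c2⟩ <;>
      simp only [a1, a2, b1, b2, c1, c2, if_true, if_false] at hc ⊢ <;>
      first
      | (exfalso; linarith)
      | (left; linarith)
      | (right; linarith)

/-- An injection of the three colours into the nonzero elements of the Klein four-group. -/
def colorValue (i : Fin 3) : ZMod 2 × ZMod 2 := ![(0, 1), (1, 0), (1, 1)] i

open scoped Classical in
-- The three nonzero elements of the Klein four-group add up to zero.
theorem exists_isValuation_of_colorable {V : Type} [Fintype V] {G : SimpleGraph V} (hG : IsCubic G)
    (h : G.lineGraph.Colorable 3) :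
    ∃ φ : V → V → ZMod 2 × ZMod 2, IsValuation Neg.neg {x | x ≠ 0} {0} G φ 0 := by
  obtain ⟨C⟩ := h
  let c : V → V → Fin 3 := fun u v => if h : G.Adj u v then C ⟨s(u, v), h⟩ else 0
  have hc : ∀ u v, c u v = c v u := by
    intro u v
    simp only [c, G.adj_comm v u, Sym2.eq_swap (a := v)]
  have hne : ∀ v x y, G.Adj v x → G.Adj v y → x ≠ y → c v x ≠ c v y := by
    intro v x y hx hy hxy
    simp only [c, dif_pos hx, dif_pos hy]
    refine C.valid ?_
    rw [SimpleGraph.lineGraph_adj_iff_exists]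
    refine ⟨?_, v, ?_, ?_⟩
    · intro h
      exact hxy (Sym2.congr_right.1 (Subtype.ext_iff.1 h))
    · simp
    · simp
  refine ⟨fun u v => if G.Adj u v then colorValue (c u v) else 0, fun u v => ?_,
    fun u v huv => if_neg huv, fun u v huv => ?_, fun v => ?_⟩
  · simp only [G.adj_comm v u, hc v u]
    generalize c u v = i
    split_ifs
    · revert i
      decide
    · rfl
  · simp only [if_pos huv]
    generalize c u v = i
    revert i
    decide
  · obtain ⟨x, y, z, hxy, hxz, hyz, hv⟩ := hG.exists_neighbors v
    have hx := (hv x).2 (by simp)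
    have hy := (hv y).2 (by simp)
    have hz := (hv z).2 (by simp)
    rw [sum_eq_of_neighbors hxy hxz hyz hv (fun u hu => if_neg hu)]
    simp only [if_pos hx, if_pos hy, if_pos hz]
    have h1 := hne v x y hx hy hxy
    have h2 := hne v x z hx hz hxz
    have h3 := hne v y z hy hz hyz
    revert h1 h2 h3
    generalize c v x = i
    generalize c v y = j
    generalize c v z = k
    simp only [Pi.zero_apply, add_zero, Set.mem_singleton_iff]
    revert i j k
    decide

/-! ### Cubicity and order of the family -/

theorem isCubic_snarkFamily (n : ℕ) : IsCubic (snarkFamily (n + 1)).graph := by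
  have hp : PieceValuable id ({1} : Set ℕ) {3} 1 1 1 1 1 1 := by
    refine ⟨1, 1, 1, 1, 1, 1, 1, 1, 1, ?_⟩
    constructor <;> simp
  have h : (snarkFamily (n + 1)).HasValuation id ({1} : Set ℕ) {3} 1 1 1 1 := by
    induction n with
    | zero =>
      refine hasValuation_markedPetersen (p := 1) (q := 1) (s := 1) (t := 1) (fun _ => rfl) rfl
        (fun _ h => h) ?_ ?_ ?_ ?_ ?_ ?_ ?_ ?_ ?_ ?_ hp <;> simp
    | succ n ih =>
      exact ih.extend (fun _ => rfl) rfl (fun _ h => h) rfl rfl rfl hp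
  obtain ⟨φ, hφ⟩ := h.exists_isValuation (fun _ => rfl)
  exact isCubic_of_isValuation hφ

theorem card_snarkFamily (n : ℕ) : Fintype.card (snarkFamily (n + 1)).V = 8 * (n + 1) + 2 := by
  induction n with
  | zero => exact Fintype.card_fin 10
  | succ n ih =>
    have h : Fintype.card (snarkFamily (n + 2)).V = Fintype.card (snarkFamily (n + 1)).V +
        Fintype.card {h : Fin 10 // h ≠ 0 ∧ h ≠ 1} := Fintype.card_sum
    have h8 : Fintype.card {h : Fin 10 // h ≠ 0 ∧ h ≠ 1} = 8 := by decide
    rw [h, ih, h8]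
    ring

/-! ### Propagation of defects, and the absence of 3-edge-colourings -/

/-- If the valuations of a piece of the chain propagate a defect in `N j` to a defect in `N (j + 1)`,
and the defects in `N k` cannot be closed up, then the `k`-th graph has no valuation. -/
theorem not_isValuation_snarkFamily {A : Type} [AddCommGroup A] {B D : Set A} (N : ℕ → Set A) {k : ℕ}
    (hN : 0 ∈ N 0) (hB : ∀ x ∈ B, -x ∈ B)
    (hP : ∀ j, j + 1 ≤ k → ∀ p ∈ B, ∀ q ∈ B, ∀ s ∈ B, ∀ t ∈ B, ∀ γ ∈ B, ∀ δ ∈ B,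
      PieceValuable Neg.neg B D p q s t γ δ → γ + δ ∈ N j →
        p + q ∈ N (j + 1) ∧ p + q + s + t + γ + δ = 0)
    (hD : ∀ j ≤ k, ∀ x ∈ N j, ∀ α ∈ B, -x + α ∉ D) (hk : 1 ≤ k)
    (φ : (snarkFamily k).V → (snarkFamily k).V → A) :
    ¬ IsValuation Neg.neg B D (snarkFamily k).graph φ 0 := by
  -- Here `j` counts the pieces already stripped from the end of the chain and `n + 1` those that
  -- remain.
  have key : ∀ n j, n + 1 + j ≤ k → ∀ α β γ δ, α + β + γ + δ = 0 → γ + δ ∈ N j →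
      ¬ (snarkFamily (n + 1)).HasValuation Neg.neg B D α β γ δ := by
    intro n
    induction n with
    | zero =>
      intro j hj α β γ δ _ hγδ h
      obtain ⟨p, hp, q, hq, s, hs, t, ht, h0, -, hpv⟩ := exists_of_hasValuation_markedPetersen h
      obtain ⟨hα, -, hγ, hδ, -⟩ := h
      have h1 := (hP j (by omega) p hp q hq s hs t ht δ hδ γ hγ hpv (by rwa [add_comm])).1
      refine hD (j + 1) (by omega) _ h1 α hα ?_
      rwa [neg_add]
    | succ n ih =>
      intro j hj α β γ δ hsum hγδ h
      obtain ⟨α', β', γ', h', hpv⟩ := MarkedGraph.HasValuation.restrict h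
      obtain ⟨hα, -, hγ, hδ, -⟩ := h
      obtain ⟨hα', hβ', hγ', hβ, -⟩ := id h'
      obtain ⟨h1, h2⟩ := hP j (by omega) _ (hB _ hα') _ (hB _ hβ') _ (hB _ hγ') α hα γ hγ δ hδ hpv hγδ
      -- The values leaving the piece have sum zero, and so do those leaving the larger graph; hence
      -- so do those leaving the smaller one. This turns `p + q = -α' - β'` into the defect `γ' + β`
      -- of the next piece.
      have h3 : α' + β' + γ' + β = 0 := by
        calc α' + β' + γ' + β = -(-α' + -β' + -γ' + α + γ + δ) + (α + β + γ + δ) := by abel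
          _ = 0 := by rw [h2, hsum, neg_zero, add_zero]
      refine ih (j + 1) (by omega) α' β' γ' β h3 ?_ h'
      convert h1 using 1
      rw [← sub_eq_zero, ← h3]
      abel
  intro h
  obtain ⟨n, rfl⟩ := Nat.exists_eq_add_of_le' hk
  -- An uncut graph gives opposite values on the two halves of each selected edge, so the induction
  -- starts with defect zero.
  obtain ⟨α, -, γ, -, h⟩ := MarkedGraph.hasValuation_of_isValuation h neg_zero
  exact key n 0 le_rfl _ _ _ _ (by abel) (by simpa using hN) h

set_option synthInstance.maxSize 1000 in
set_option synthInstance.maxHeartbeats 200000 in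
set_option maxRecDepth 10000 in
-- Since `γ + δ = 0`, the edge 34 can be rejoined, and the vertex equations add up to `p + q + s + t
-- = 0`. If `p + q` were nonzero, it could be put on the edge 01, and the Petersen graph would be
-- 3-edge-colourable. The first claim is checked here by enumeration.
theorem PieceValuable.klein_four {p q s t γ δ : ZMod 2 × ZMod 2}
    (h : PieceValuable Neg.neg {x | x ≠ 0} {0} p q s t γ δ) (hp : p ≠ 0) (hq : q ≠ 0) (hs : s ≠ 0)
    (ht : t ≠ 0) (hγ : γ ≠ 0) (hγδ : γ + δ = 0) :
    p + q = 0 ∧ p + q + s + t + γ + δ = 0 := by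
  obtain ⟨e23, e27, e38, e49, e57, e58, e68, e69, e79, m23, m27, m38, m49, m57, m58, m68, m69, m79,
    v2, v3, v4, v5, v6, v7, v8, v9⟩ := h
  have hn : ∀ x : ZMod 2 × ZMod 2, -x = x := by decide
  simp only [Set.mem_ofPred_eq, Set.mem_singleton_iff] at *
  refine ⟨?_, by linear_combination v2 + v3 + v4 + v5 + v6 + v7 + v8 + v9⟩
  -- Six edge values determine all the others. Each condition stands as early as possible, so that
  -- the evaluation prunes its branches.
  have key : ∀ e23 : ZMod 2 × ZMod 2, e23 ≠ 0 → ∀ e27, e27 ≠ 0 → -e23 - e27 ≠ 0 → ∀ e38, e38 ≠ 0 →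
      e23 - e38 ≠ 0 → ∀ e57, e57 ≠ 0 → e27 + e57 ≠ 0 → ∀ e58, e58 ≠ 0 → -e57 - e58 ≠ 0 →
      -e38 - e58 ≠ 0 → ∀ e49, e49 ≠ 0 → -e49 - (e27 + e57) ≠ 0 → -e49 + (e23 - e38) ≠ 0 →
      -(-e38 - e58) - (-e49 - (e27 + e57)) ≠ 0 →
      -e49 + (e23 - e38) + (-e57 - e58) = 0 := by decide
  obtain rfl : e79 = e27 + e57 := by linear_combination v7
  obtain rfl : e68 = -e38 - e58 := by linear_combination -v8
  obtain rfl : e69 = -e49 - (e27 + e57) := by linear_combination -v9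
  obtain rfl : γ = e23 - e38 := by linear_combination v3
  obtain rfl : δ = -(e23 - e38) := by linear_combination hγδ
  obtain rfl : p = -e49 + (e23 - e38) := by linear_combination v4
  obtain rfl : q = -e57 - e58 := by linear_combination v5
  obtain rfl : s = -e23 - e27 := by linear_combination v2
  obtain rfl : t = -(-e38 - e58) - (-e49 - (e27 + e57)) := by linear_combination v6
  exact key e23 m23 e27 m27 hs e38 m38 hγ e57 m57 m79 e58 m58 hq m68 e49 m49 m69 hp ht

theorem not_colorable_snarkFamily {k : ℕ} (hk : 1 ≤ k) :
    ¬ (snarkFamily k).graph.lineGraph.Colorable 3 := by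
  intro h
  obtain ⟨n, rfl⟩ := Nat.exists_eq_add_of_le' hk
  obtain ⟨φ, hφ⟩ := exists_isValuation_of_colorable (isCubic_snarkFamily n) h
  refine not_isValuation_snarkFamily (B := {x | x ≠ 0}) (fun _ => {0}) rfl (fun x hx => neg_ne_zero.2 hx) ?_ ?_ hk φ hφ
  · intro j _ p hp q hq s hs t ht γ hγ δ hδ h hγδ
    exact h.klein_four hp hq hs ht hγ hγδ
  · rintro j _ x rfl α hα
    simpa using hα

/-! ### The upper bound: an explicit flow -/

namespace MarkedGraph

theorem HasValuation.neg {A : Type} [AddCommGroup A] {B D : Set A} {M : MarkedGraph} {α β γ δ : A}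
    (hB : ∀ x ∈ B, -x ∈ B) (hD : ∀ x ∈ D, -x ∈ D) (h : M.HasValuation Neg.neg B D α β γ δ) :
    M.HasValuation Neg.neg B D (-α) (-β) (-γ) (-δ) := by
  obtain ⟨hα, hβ, hγ, hδ, φ, h⟩ := h
  refine ⟨hB _ hα, hB _ hβ, hB _ hγ, hB _ hδ, fun u v => -φ u v, fun u v => ?_, fun u v huv => ?_,
    fun u v huv => hB _ (h.mem u v huv), fun v => ?_⟩
  · rw [h.symm u v]
  · rw [h.eq_zero u v huv, neg_zero]
  · have h1 : M.ends (-α) (-β) (-γ) (-δ) v = -M.ends α β γ δ v := by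
      simp only [ends, neg_add]
      congr 1
      · congr 1
        · congr 1
          · split_ifs <;> simp
          · split_ifs <;> simp
        · split_ifs <;> simp
      · split_ifs <;> simp
    rw [h1, Finset.sum_neg_distrib, ← neg_add]
    exact hD _ (h.sum_mem v)

end MarkedGraph

theorem nonempty_circularNowhereZeroFlow_snarkFamily {k : ℕ} (hk : 1 ≤ k) :
    Nonempty (CircularNowhereZeroFlow (snarkFamily k).graph (4 + 1 / (k : ℝ))) := by
  set s : ℝ := 1 / (k : ℝ) with hs
  have hk0 : (0 : ℝ) < k := by exact_mod_cast hk
  have hk1 : (1 : ℝ) ≤ k := by exact_mod_cast hk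
  have hs0 : 0 < s := by positivity
  have hsk : k * s = 1 := by rw [hs]; field_simp
  have hs1 : s ≤ 1 := by rw [← hsk]; nlinarith
  set B : Set ℝ := {x | 1 ≤ |x| ∧ |x| ≤ 4 + s - 1} with hB
  have hBneg : ∀ x ∈ B, -x ∈ B := fun x hx => by simpa [hB] using hx
  have hpos : ∀ x, 1 ≤ x → x ≤ 3 + s → x ∈ B := by
    intro x h1 h2
    rw [hB, Set.mem_ofPred_eq, abs_of_pos (by linarith)]
    constructor <;> linarith
  have hneg : ∀ x, x ≤ -1 → -(3 + s) ≤ x → x ∈ B := by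
    intro x h1 h2
    rw [hB, Set.mem_ofPred_eq, abs_of_neg (by linarith)]
    constructor <;> linarith
  -- The defect `γ + δ` is `1 - (n + 1) * s`, that is `(k - 1 - n) * s`: it falls by `s` with each
  -- added piece and is 0 at `n + 1 = k`.
  have key : ∀ n : ℕ, n + 1 ≤ k → (snarkFamily (n + 1)).HasValuation Neg.neg B {0} (1 + s)
      (-2 + (n + 1) * s - s) (-1) (2 - (n + 1) * s) := by
    intro n
    induction n with
    | zero =>
      intro _
      refine hasValuation_markedPetersen (p := -1) (q := 2 + s) (s := -1) (t := -1) neg_neg neg_zero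
        hBneg ?_ ?_ ?_ ?_ ?_ ?_ ?_ ?_ ?_ ?_
        ⟨3, -2, 1 + s, 2, 1, -(3 + s), 2, -1, -1, ?_⟩
      on_goal 11 => constructor
      all_goals first
        | (refine hpos _ ?_ ?_ <;> push_cast <;> linarith)
        | (refine hneg _ ?_ ?_ <;> push_cast <;> linarith)
        | (rw [Set.mem_singleton_iff]; push_cast; ring)
    | succ n ih =>
      intro hn
      have ht : ((n : ℝ) + 2) * s ≤ 1 := by
        rw [← hsk]
        refine mul_le_mul_of_nonneg_right ?_ hs0.le
        exact_mod_cast hn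
      have ht0 : 0 ≤ (n : ℝ) * s := by positivity
      -- Reversing the earlier flow makes its value at `d` agree with the value required at the new
      -- `b`.
      have hprev := (ih (by omega)).neg hBneg (by simp)
      rw [show -(2 - ((n : ℝ) + 1) * s) = -2 + ((n + 1 : ℕ) + 1 : ℝ) * s - s by push_cast; ring]
        at hprev
      refine hprev.extend neg_neg neg_zero hBneg ?_ ?_ ?_
        ⟨2 + s, -1 - s, 3 + s, (n + 1) * s - 3, 3 - (n + 1) * s + s, -1, -2 - s, 1,
          2 - (n + 1) * s, ?_⟩
      on_goal 4 => constructor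
      all_goals first
        | (refine hpos _ ?_ ?_ <;> push_cast <;> linarith)
        | (refine hneg _ ?_ ?_ <;> push_cast <;> linarith)
        | (rw [Set.mem_singleton_iff]; push_cast; ring)
  obtain ⟨n, rfl⟩ := Nat.exists_eq_add_of_le' hk
  have h := key n le_rfl
  have hn : ((n : ℝ) + 1) * s = 1 := by exact_mod_cast hsk
  -- Because `k * s = 1`, the two halves of each selected edge now carry opposite values and can be
  -- rejoined.
  rw [hn, show -2 + 1 - s = -(1 + s) by ring, show (2 : ℝ) - 1 = -(-1) by norm_num] at h
  obtain ⟨φ, hφ⟩ := h.exists_isValuation neg_neg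
  exact nonempty_circularNowhereZeroFlow hφ

/-! ### The lower bound: growth of the defect -/

set_option maxHeartbeats 1000000 in
-- The vertices get the signs of their sums. No path on three vertices has a constant sign, and this
-- leaves few sign patterns. Adjacent vertices of equal sign force the four edges leaving the pair
-- to be nearly extremal, and linear arithmetic then either refutes the pattern or yields both
-- claims. Unlike in a group with `D = {0}`, the vanishing of the total is not automatic: it says
-- that the two signs are equally frequent.
theorem PieceValuable.abs_add_le {ε x p q s t γ δ : ℝ} (hx : x + ε < 1)
    (h : PieceValuable Neg.neg {y : ℝ | |y| ≤ 1 + ε / 2} {2 + ε / 2, -(2 + ε / 2)} p q s t γ δ)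
    (hp : |p| ≤ 1 + ε / 2) (hq : |q| ≤ 1 + ε / 2) (hs : |s| ≤ 1 + ε / 2) (ht : |t| ≤ 1 + ε / 2)
    (hγ : |γ| ≤ 1 + ε / 2) (hδ : |δ| ≤ 1 + ε / 2) (hγδ : |γ + δ| ≤ x) :
    |p + q| ≤ x + ε ∧ p + q + s + t + γ + δ = 0 := by
  obtain ⟨e23, e27, e38, e49, e57, e58, e68, e69, e79, h23, h27, h38, h49, h57, h58, h68, h69, h79,
    v2, v3, v4, v5, v6, v7, v8, v9⟩ := h
  simp only [Set.mem_ofPred_eq, Set.mem_insert_iff, Set.mem_singleton_iff, abs_le] at *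
  obtain ⟨hp1, hp2⟩ := hp
  obtain ⟨hq1, hq2⟩ := hq
  obtain ⟨hs1, hs2⟩ := hs
  obtain ⟨ht1, ht2⟩ := ht
  obtain ⟨a23, b23⟩ := h23
  obtain ⟨a27, b27⟩ := h27
  obtain ⟨a38, b38⟩ := h38
  obtain ⟨a49, b49⟩ := h49
  obtain ⟨a57, b57⟩ := h57
  obtain ⟨a58, b58⟩ := h58
  obtain ⟨a68, b68⟩ := h68
  obtain ⟨a69, b69⟩ := h69
  obtain ⟨a79, b79⟩ := h79
  obtain ⟨hγ1, hγ2⟩ := hγ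
  obtain ⟨hδ1, hδ2⟩ := hδ
  obtain ⟨x1, x2⟩ := hγδ
  have hε : ε < 1 := by linarith
  have sign : ∀ {y : ℝ}, y = 2 + ε / 2 ∨ y = -(2 + ε / 2) →
      ∃ b : Bool, y = if b then 2 + ε / 2 else -(2 + ε / 2) := by
    rintro y (h | h)
    · exact ⟨true, by simp [h]⟩
    · exact ⟨false, by simp [h]⟩
  obtain ⟨s2, v2⟩ := sign v2
  obtain ⟨s3, v3⟩ := sign v3
  obtain ⟨s4, v4⟩ := sign v4
  obtain ⟨s5, v5⟩ := sign v5
  obtain ⟨s6, v6⟩ := sign v6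
  obtain ⟨s7, v7⟩ := sign v7
  obtain ⟨s8, v8⟩ := sign v8
  obtain ⟨s9, v9⟩ := sign v9
  -- Five edges leave a path on three vertices, so the sum over it has modulus at most `5 * (1 + ε /
  -- 2)`. This is below `3 * (2 + ε / 2)` exactly when `ε < 1`. The same estimate excludes the other
  -- twelve paths.
  have n758 : ¬ (s7 = s5 ∧ s5 = s8) := by
    rintro ⟨rfl, rfl⟩
    cases s7 <;> simp only [if_true, Bool.false_eq_true, if_false] at v7 v5 v8 <;>
      linarith only [hε, v7, v5, v8, a27, b27, a38, b38, a68, b68, a79, b79, hq1, hq2]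
  have n385 : ¬ (s3 = s8 ∧ s8 = s5) := by
    rintro ⟨rfl, rfl⟩
    cases s3 <;> simp only [if_true, Bool.false_eq_true, if_false] at v3 v8 v5 <;>
      linarith only [hε, v3, v8, v5, a23, b23, a57, b57, a68, b68, hγ1, hγ2, hq1, hq2]
  have n386 : ¬ (s3 = s8 ∧ s8 = s6) := by
    rintro ⟨rfl, rfl⟩
    cases s3 <;> simp only [if_true, Bool.false_eq_true, if_false] at v3 v8 v6 <;>
      linarith only [hε, v3, v8, v6, a23, b23, a58, b58, a69, b69, hγ1, hγ2, ht1, ht2]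
  have n586 : ¬ (s5 = s8 ∧ s8 = s6) := by
    rintro ⟨rfl, rfl⟩
    cases s5 <;> simp only [if_true, Bool.false_eq_true, if_false] at v5 v8 v6 <;>
      linarith only [hε, v5, v8, v6, a38, b38, a57, b57, a69, b69, hq1, hq2, ht1, ht2]
  have n238 : ¬ (s2 = s3 ∧ s3 = s8) := by
    rintro ⟨rfl, rfl⟩
    cases s2 <;> simp only [if_true, Bool.false_eq_true, if_false] at v2 v3 v8 <;>
      linarith only [hε, v2, v3, v8, a27, b27, a58, b58, a68, b68, hs1, hs2, hγ1, hγ2]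
  have n327 : ¬ (s3 = s2 ∧ s2 = s7) := by
    rintro ⟨rfl, rfl⟩
    cases s3 <;> simp only [if_true, Bool.false_eq_true, if_false] at v3 v2 v7 <;>
      linarith only [hε, v3, v2, v7, a38, b38, a57, b57, a79, b79, hγ1, hγ2, hs1, hs2]
  have n275 : ¬ (s2 = s7 ∧ s7 = s5) := by
    rintro ⟨rfl, rfl⟩
    cases s2 <;> simp only [if_true, Bool.false_eq_true, if_false] at v2 v7 v5 <;>
      linarith only [hε, v2, v7, v5, a23, b23, a58, b58, a79, b79, hs1, hs2, hq1, hq2]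
  have n279 : ¬ (s2 = s7 ∧ s7 = s9) := by
    rintro ⟨rfl, rfl⟩
    cases s2 <;> simp only [if_true, Bool.false_eq_true, if_false] at v2 v7 v9 <;>
      linarith only [hε, v2, v7, v9, a23, b23, a49, b49, a57, b57, a69, b69, hs1, hs2]
  have n579 : ¬ (s5 = s7 ∧ s7 = s9) := by
    rintro ⟨rfl, rfl⟩
    cases s5 <;> simp only [if_true, Bool.false_eq_true, if_false] at v5 v7 v9 <;>
      linarith only [hε, v5, v7, v9, a27, b27, a49, b49, a58, b58, a69, b69, hq1, hq2]
  have n869 : ¬ (s8 = s6 ∧ s6 = s9) := by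
    rintro ⟨rfl, rfl⟩
    cases s8 <;> simp only [if_true, Bool.false_eq_true, if_false] at v8 v6 v9 <;>
      linarith only [hε, v8, v6, v9, a38, b38, a49, b49, a58, b58, a79, b79, ht1, ht2]
  have n796 : ¬ (s7 = s9 ∧ s9 = s6) := by
    rintro ⟨rfl, rfl⟩
    cases s7 <;> simp only [if_true, Bool.false_eq_true, if_false] at v7 v9 v6 <;>
      linarith only [hε, v7, v9, v6, a27, b27, a49, b49, a57, b57, a68, b68, ht1, ht2]
  have n496 : ¬ (s4 = s9 ∧ s9 = s6) := by
    rintro ⟨rfl, rfl⟩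
    cases s4 <;> simp only [if_true, Bool.false_eq_true, if_false] at v4 v9 v6 <;>
      linarith only [hε, v4, v9, v6, a68, b68, a79, b79, hp1, hp2, hδ1, hδ2, ht1, ht2]
  have n497 : ¬ (s4 = s9 ∧ s9 = s7) := by
    rintro ⟨rfl, rfl⟩
    cases s4 <;> simp only [if_true, Bool.false_eq_true, if_false] at v4 v9 v7 <;>
      linarith only [hε, v4, v9, v7, a27, b27, a57, b57, a69, b69, hp1, hp2, hδ1, hδ2]
  cases s8 <;>
  (
    cases s5 <;>
    (
      cases s7 <;>
      first
      | exact (n758 ⟨rfl, rfl⟩).elim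
      | (
        cases s3 <;>
        first
        | exact (n385 ⟨rfl, rfl⟩).elim
        | (
          cases s6 <;>
          first
          | exact (n386 ⟨rfl, rfl⟩).elim
          | exact (n586 ⟨rfl, rfl⟩).elim
          | (
            cases s2 <;>
            first
            | exact (n238 ⟨rfl, rfl⟩).elim
            | exact (n327 ⟨rfl, rfl⟩).elim
            | exact (n275 ⟨rfl, rfl⟩).elim
            | (
              cases s9 <;>
              first
              | exact (n279 ⟨rfl, rfl⟩).elim
              | exact (n579 ⟨rfl, rfl⟩).elim
              | exact (n869 ⟨rfl, rfl⟩).elim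
              | exact (n796 ⟨rfl, rfl⟩).elim
              | (
                cases s4 <;>
                first
                | exact (n496 ⟨rfl, rfl⟩).elim
                | exact (n497 ⟨rfl, rfl⟩).elim
                | (
                  simp only [if_true, Bool.false_eq_true, if_false] at v2 v3 v4 v5 v6 v7 v8 v9
                  first
                  | (exfalso; linarith)
                  | exact ⟨⟨by linarith, by linarith⟩, by linarith⟩))))))))

theorem not_nonempty_circularNowhereZeroFlow_snarkFamily {k : ℕ} (hk : 1 ≤ k) {r : ℝ} (hr : 4 ≤ r)
    (hrk : k * (r - 4) < 1) : IsEmpty (CircularNowhereZeroFlow (snarkFamily k).graph r) := by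
  refine ⟨fun F => ?_⟩
  obtain ⟨φ, hφ⟩ : ∃ φ, IsValuation Neg.neg {x | |x| ≤ r / 2 - 1} {r / 2, -(r / 2)}
      (snarkFamily k).graph φ 0 := by
    obtain ⟨n, rfl⟩ := Nat.exists_eq_add_of_le' hk
    exact F.exists_isValuation (isCubic_snarkFamily n)
  obtain ⟨ε, rfl⟩ : ∃ ε, r = 4 + ε := ⟨r - 4, by ring⟩
  rw [show (4 + ε) / 2 = 2 + ε / 2 by ring, show 2 + ε / 2 - 1 = 1 + ε / 2 by ring] at hφ
  have hε : 0 ≤ ε := by linarith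
  have hsmall : ∀ j ≤ k, (j : ℝ) * ε < 1 := by
    intro j hj
    refine lt_of_le_of_lt ?_ hrk
    rw [add_sub_cancel_left]
    exact mul_le_mul_of_nonneg_right (by exact_mod_cast hj) hε
  refine not_isValuation_snarkFamily (fun j => {x : ℝ | |x| ≤ j * ε}) (by simp) ?_ ?_ ?_ hk φ hφ
  · intro x hx
    simpa using hx
  · intro j hj p hp q hq s hs t ht γ hγ δ hδ h hγδ
    have h1 : ((j + 1 : ℕ) : ℝ) * ε = j * ε + ε := by push_cast; ring
    rw [h1]
    exact h.abs_add_le (h1 ▸ hsmall _ hj) hp hq hs ht hγ hδ hγδ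
  -- At vertex 0 the modulus is at most `j * ε + 1 + ε / 2`, which is below `2 + ε / 2`.
  · intro j hj x hx α hα h
    have h1 := hsmall j hj
    simp only [Set.mem_ofPred_eq, abs_le] at hx hα
    rcases h with h | h
    · linarith [hx.1, hα.2]
    · rw [Set.mem_singleton_iff] at h
      linarith [hx.2, hα.1]

/-- A circular flow is also a circular flow with a larger parameter. -/
def CircularNowhereZeroFlow.mono {V : Type} [Fintype V] {G : SimpleGraph V} {r r' : ℝ} (h : r ≤ r')
    (F : CircularNowhereZeroFlow G r) : CircularNowhereZeroFlow G r' :=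
  { F with mem_Icc := fun e he => ⟨(F.mem_Icc e he).1, (F.mem_Icc e he).2.trans (by linarith)⟩ }

theorem isCircularFlowNumber_snarkFamily {k : ℕ} (hk : 1 ≤ k) :
    IsCircularFlowNumber (snarkFamily k).graph (4 + 1 / (k : ℝ)) := by
  have hk0 : (0 : ℝ) < k := by exact_mod_cast hk
  have h0 : 0 < 1 / (k : ℝ) := by positivity
  refine ⟨⟨by linarith, nonempty_circularNowhereZeroFlow_snarkFamily hk⟩, ?_⟩
  rintro r ⟨-, ⟨F⟩⟩
  by_contra hr
  push Not at hr
  -- The defect estimates need `ε ≥ 0`, so a flow with `r < 4` is first regarded as a flow with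
  -- parameter 4.
  refine (not_nonempty_circularNowhereZeroFlow_snarkFamily hk (le_max_right r 4) ?_).false
    (F.mono (le_max_left r 4))
  rw [← lt_div_iff₀' hk0]
  rcases max_cases r 4 with h | h <;> linarith

/-! ### Girth -/

theorem five_le_egirth {V : Type} {G : SimpleGraph V}
    (h3 : ∀ u v w, G.Adj u v → G.Adj v w → ¬ G.Adj w u)
    (h4 : ∀ u v w x, G.Adj u v → G.Adj v w → G.Adj w x → G.Adj x u → u = w ∨ v = x) :
    5 ≤ G.egirth := by
  rw [SimpleGraph.le_egirth]
  intro u w hw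
  have h := hw.three_le_length
  by_contra hlt
  have hlt' : w.length < 5 := by
    by_contra h5
    exact hlt (by exact_mod_cast not_lt.1 h5)
  match w, hw with
  | .cons _ .nil, _ => simp at h
  | .cons _ (.cons _ .nil), _ => simp at h
  | .cons a (.cons b (.cons c .nil)), _ => exact h3 _ _ _ a b c
  | .cons a (.cons b (.cons c (.cons d .nil))), hw =>
    have hn := hw.support_nodup
    simp at hn
    rcases h4 _ _ _ _ a b c d with h | h <;> tauto
  | .cons _ (.cons _ (.cons _ (.cons _ (.cons _ p)))), _ =>
    simp at hlt'
    omega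

theorem petersenGraph_no_triangle :
    ∀ u v w, petersenGraph.Adj u v → petersenGraph.Adj v w → ¬ petersenGraph.Adj w u := by
  decide

theorem petersenGraph_no_square : ∀ u v, petersenGraph.Adj u v → ∀ w, petersenGraph.Adj v w → ∀ x,
    petersenGraph.Adj w x → petersenGraph.Adj x u → u = w ∨ v = x := by
  decide

namespace MarkedGraph

variable {M : MarkedGraph}

theorem eq_old_or_eq_new (x : M.dotPetersen.V) : (∃ v, x = M.old v) ∨ ∃ i, x = M.new i := by
  revert x
  rw [forall_dotPetersen]
  exact ⟨fun v => Or.inl ⟨v, rfl⟩, fun i => Or.inr ⟨i, rfl⟩⟩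

theorem cutGraph_le : M.cutGraph ≤ M.graph := fun _ _ h => (cutGraph_adj.1 h).1

theorem dotPetersen_no_triangle (h : ∀ u v w, M.graph.Adj u v → M.graph.Adj v w → ¬ M.graph.Adj w u) :
    ∀ u v w, M.dotPetersen.graph.Adj u v → M.dotPetersen.graph.Adj v w →
      ¬ M.dotPetersen.graph.Adj w u := by
  have hab := M.adj_ab.ne
  have hcd := M.adj_cd.ne
  have hac := M.ne_ac
  have had := M.ne_ad
  have hbc := M.ne_bc
  have hbd := M.ne_bd
  have hP := petersenGraph_no_triangle
  have hc : ∀ {u v}, M.cutGraph.Adj u v → M.graph.Adj u v := fun h => cutGraph_le h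
  have hi : ∀ u, ¬ M.cutGraph.Adj u u := fun u => M.cutGraph.loopless.irrefl u
  have hi' : ∀ u, ¬ petersenGraph.Adj u u := fun u => petersenGraph.loopless.irrefl u
  intro u v w
  obtain ⟨u, rfl⟩ | ⟨u, rfl⟩ := eq_old_or_eq_new u <;>
  obtain ⟨v, rfl⟩ | ⟨v, rfl⟩ := eq_old_or_eq_new v <;>
  obtain ⟨w, rfl⟩ | ⟨w, rfl⟩ := eq_old_or_eq_new w <;>
  simp only [dotPetersen_adj_old_old, dotPetersen_adj_old_new, dotPetersen_adj_new_old,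
    dotPetersen_adj_new_new]
  · exact fun h1 h2 h3 => h _ _ _ (hc h1) (hc h2) (hc h3)
  all_goals grind

theorem dotPetersen_no_square
    (h : ∀ u v w x, M.graph.Adj u v → M.graph.Adj v w → M.graph.Adj w x → M.graph.Adj x u →
      u = w ∨ v = x) : ∀ u v w x, M.dotPetersen.graph.Adj u v → M.dotPetersen.graph.Adj v w →
      M.dotPetersen.graph.Adj w x → M.dotPetersen.graph.Adj x u → u = w ∨ v = x := by
  have hab := M.adj_ab.ne
  have hcd := M.adj_cd.ne
  have hac := M.ne_ac
  have had := M.ne_ad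
  have hbc := M.ne_bc
  have hbd := M.ne_bd
  have hP := petersenGraph_no_square
  have hc : ∀ {u v}, M.cutGraph.Adj u v → M.graph.Adj u v := fun h => cutGraph_le h
  -- The connecting edges form a matching whose ends in the new piece are pairwise nonadjacent.
  -- Hence no 4-cycle passes through two of them.
  have hn : ∀ i j, (i = 4 ∨ i = 5 ∨ i = 2 ∨ i = 6) → (j = 4 ∨ j = 5 ∨ j = 2 ∨ j = 6) →
      ¬ petersenGraph.Adj i j := by decide
  intro u v w x
  obtain ⟨u, rfl⟩ | ⟨u, rfl⟩ := eq_old_or_eq_new u <;>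
  obtain ⟨v, rfl⟩ | ⟨v, rfl⟩ := eq_old_or_eq_new v <;>
  obtain ⟨w, rfl⟩ | ⟨w, rfl⟩ := eq_old_or_eq_new w <;>
  obtain ⟨x, rfl⟩ | ⟨x, rfl⟩ := eq_old_or_eq_new x <;>
  simp only [dotPetersen_adj_old_old, dotPetersen_adj_old_new, dotPetersen_adj_new_old,
    dotPetersen_adj_new_new, old_inj, new_inj, old_ne_new, new_ne_old, or_false, false_or,
    Subtype.ext_iff]
  · exact fun h1 h2 h3 h4 => h _ _ _ _ (hc h1) (hc h2) (hc h3) (hc h4)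
  all_goals grind

end MarkedGraph

theorem five_le_egirth_snarkFamily (n : ℕ) : 5 ≤ (snarkFamily (n + 1)).graph.egirth := by
  refine five_le_egirth ?_ ?_
  · induction n with
    | zero => exact petersenGraph_no_triangle
    | succ n ih => exact MarkedGraph.dotPetersen_no_triangle ih
  · induction n with
    | zero => exact fun u v w x h1 h2 h3 h4 => petersenGraph_no_square u v h1 w h2 x h3 h4
    | succ n ih => exact MarkedGraph.dotPetersen_no_square ih

/-! ### Small edge cuts and cyclic connectivity -/

/-- The number which is `1` if two truth values differ and `0` otherwise. -/
def boolDiff (p q : Bool) : ℕ := (p ^^ q).toNat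

/-- The number of edges leaving a vertex set which meets the part of the dot product from the Petersen
graph as told by `x2`, …, `x9` and contains the ends `a`, `b`, `c`, `d` of the selected edges or not:
only the edges of this part, and those joining it to the rest, are counted. -/
def pieceCut (a b c d x2 x3 x4 x5 x6 x7 x8 x9 : Bool) : ℕ :=
  boolDiff a x4 + boolDiff b x5 + boolDiff c x2 + boolDiff d x6 + boolDiff x2 x3 + boolDiff x2 x7 +
    boolDiff x3 x4 + boolDiff x3 x8 + boolDiff x4 x9 + boolDiff x5 x7 + boolDiff x5 x8 +
    boolDiff x6 x8 + boolDiff x6 x9 + boolDiff x7 x9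

set_option maxRecDepth 100000 in
-- The piece replaces the edges `ab` and `cd` by the edge-disjoint paths a-4-9-7-5-b and
-- c-2-3-8-6-d, and a cut separating the ends of a path uses an edge of it.
theorem boolDiff_add_le_pieceCut : ∀ a b c d x2 x3 x4 x5 x6 x7 x8 x9 : Bool,
    boolDiff a b + boolDiff c d ≤ pieceCut a b c d x2 x3 x4 x5 x6 x7 x8 x9 := by
  decide

set_option maxRecDepth 100000 in
theorem count_le_one_of_pieceCut_lt_four : ∀ x2 x3 x4 x5 x6 x7 x8 x9 : Bool,
    pieceCut false false false false x2 x3 x4 x5 x6 x7 x8 x9 < 4 →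
    x2.toNat + x3.toNat + x4.toNat + x5.toNat + x6.toNat + x7.toNat + x8.toNat + x9.toNat ≤ 1 := by
  decide

set_option maxRecDepth 100000 in
-- Serves the case of a set with exactly one old vertex, which is at most one of the four selected
-- ends: with so few edges cut in the piece, the set has no new vertex.
theorem count_eq_zero_of_pieceCut_le : ∀ a b c d : Bool, a.toNat + b.toNat + c.toNat + d.toNat ≤ 1 →
    ∀ x2 x3 x4 x5 x6 x7 x8 x9 : Bool,
    pieceCut a b c d x2 x3 x4 x5 x6 x7 x8 x9 ≤ a.toNat + b.toNat + c.toNat + d.toNat →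
    x2.toNat + x3.toNat + x4.toNat + x5.toNat + x6.toNat + x7.toNat + x8.toNat + x9.toNat = 0 := by
  decide

set_option maxRecDepth 100000 in
theorem petersen_count_of_cut_lt_four : ∀ x0 x1 x2 x3 x4 x5 x6 x7 x8 x9 : Bool,
    boolDiff x0 x1 + boolDiff x0 x4 + boolDiff x0 x5 + boolDiff x1 x2 + boolDiff x1 x6 +
      boolDiff x2 x3 + boolDiff x2 x7 + boolDiff x3 x4 + boolDiff x3 x8 + boolDiff x4 x9 +
      boolDiff x5 x7 + boolDiff x5 x8 + boolDiff x6 x8 + boolDiff x6 x9 + boolDiff x7 x9 < 4 →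
    x0.toNat + x1.toNat + x2.toNat + x3.toNat + x4.toNat + x5.toNat + x6.toNat + x7.toNat +
      x8.toNat + x9.toNat ≤ 1 ∨
    (!x0).toNat + (!x1).toNat + (!x2).toNat + (!x3).toNat + (!x4).toNat + (!x5).toNat + (!x6).toNat +
      (!x7).toNat + (!x8).toNat + (!x9).toNat ≤ 1 := by
  decide

open scoped Classical in
/-- The number of edges from `X` to its complement. -/
noncomputable def cutSize {V : Type} [Fintype V] (G : SimpleGraph V) (X : Set V) : ℕ :=
  ∑ u, ∑ v, if u ∈ X ∧ v ∉ X ∧ G.Adj u v then 1 else 0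

theorem encard_edgeBoundary {V : Type} [Fintype V] (G : SimpleGraph V) (X : Set V) :
    (edgeBoundary G X).encard = cutSize G X := by
  classical
  let P : Finset (V × V) := {p | p.1 ∈ X ∧ p.2 ∉ X ∧ G.Adj p.1 p.2}
  have h1 : edgeBoundary G X = (fun p : V × V => s(p.1, p.2)) '' (P : Set (V × V)) := by
    ext e
    simp only [edgeBoundary, Set.mem_ofPred_eq, Set.mem_image, Prod.exists, P, Finset.coe_filter,
      Finset.mem_univ, true_and]
    constructor
    · rintro ⟨u, v, hu, hv, huv, rfl⟩
      exact ⟨u, v, ⟨hu, hv, huv⟩, rfl⟩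
    · rintro ⟨u, v, ⟨hu, hv, huv⟩, rfl⟩
      exact ⟨u, v, hu, hv, huv, rfl⟩
  have h2 : Set.InjOn (fun p : V × V => s(p.1, p.2)) (P : Set (V × V)) := by
    rintro ⟨u, v⟩ h ⟨u', v'⟩ h' he
    simp only [P, Finset.coe_filter, Finset.mem_univ, true_and, Set.mem_ofPred_eq] at h h'
    simp only [Sym2.eq_iff] at he
    rcases he with ⟨rfl, rfl⟩ | ⟨rfl, rfl⟩
    · rfl
    · exact absurd h.1 h'.2.1
  rw [h1, h2.encard_image, Set.encard_coe_eq_coe_finsetCard]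
  norm_cast
  rw [cutSize, ← Fintype.sum_prod_type' (f := fun u v => if u ∈ X ∧ v ∉ X ∧ G.Adj u v then 1 else 0),
    Finset.sum_boole]
  simp [P]

theorem cutSize_compl {V : Type} [Fintype V] (G : SimpleGraph V) (X : Set V) :
    cutSize G Xᶜ = cutSize G X := by
  classical
  rw [cutSize, cutSize, Finset.sum_comm]
  refine Finset.sum_congr rfl fun u _ => Finset.sum_congr rfl fun v _ => ?_
  simp only [Set.mem_compl_iff, not_not, G.adj_comm v u]
  congr 1
  exact propext ⟨fun h => ⟨h.2.1, h.1, h.2.2⟩, fun h => ⟨h.2.1, h.1, h.2.2⟩⟩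

/-- Every vertex set left by at most three edges has at most one vertex, or misses at most one. -/
def OnlyTrivialSmallCuts {V : Type} [Fintype V] (G : SimpleGraph V) : Prop :=
  ∀ X : Set V, cutSize G X < 4 → X.Subsingleton ∨ Xᶜ.Subsingleton

/-- A side with at most one vertex contains no cycle. -/
theorem OnlyTrivialSmallCuts.cyclicallyEdgeConnected {V : Type} [Fintype V] {G : SimpleGraph V}
    (h : OnlyTrivialSmallCuts G) : CyclicallyEdgeConnected G 4 := by
  intro X h1 h2
  rw [encard_edgeBoundary]
  by_contra hlt
  rcases h X (by exact_mod_cast not_le.1 hlt) with hX | hX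
  · have := hX.coe_sort
    exact h1 SimpleGraph.IsAcyclic.of_subsingleton
  · have := hX.coe_sort
    exact h2 SimpleGraph.IsAcyclic.of_subsingleton

theorem three_le_cutSize_singleton {V : Type} [Fintype V] {G : SimpleGraph V} (h : IsCubic G) (v : V) :
    3 ≤ cutSize G {v} := by
  classical
  rw [cutSize, ← Finset.add_sum_erase _ _ (Finset.mem_univ v)]
  refine le_add_right (le_of_eq ?_)
  obtain ⟨x, y, z, hxy, hxz, hyz, hv⟩ := h.exists_neighbors v
  have hx := (hv x).2 (by simp)
  have hy := (hv y).2 (by simp)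
  have hz := (hv z).2 (by simp)
  rw [sum_eq_of_neighbors hxy hxz hyz hv (fun u hu => by simp [hu])]
  simp [hx, hy, hz, hx.ne', hy.ne', hz.ne']

open scoped Classical in
-- `cutSize` sums over ordered pairs, so each edge appears in both directions, of which at most one
-- counts.
theorem ite_edge_eq_boolDiff (p q : Prop) :
    ((if p ∧ ¬ q then 1 else 0) + if q ∧ ¬ p then 1 else 0) = boolDiff (decide p) (decide q) := by
  by_cases hp : p <;> by_cases hq : q <;> simp [hp, hq, boolDiff]

open scoped Classical in
theorem subsingleton_of_sum_toNat_le_one {W : Type} [Fintype W] {p : W → Prop}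
    (h : ∑ i, (decide (p i)).toNat ≤ 1) {i j : W} (hi : p i) (hj : p j) : i = j := by
  by_contra hij
  have h1 := Finset.sum_le_sum_of_subset (f := fun i => (decide (p i)).toNat)
    (Finset.subset_univ {i, j})
  rw [Finset.sum_pair hij] at h1
  simp only [hi, hj, decide_true, Bool.toNat_true] at h1
  omega

theorem onlyTrivialSmallCuts_petersenGraph : OnlyTrivialSmallCuts petersenGraph := by
  classical
  intro X hX
  have h := petersen_count_of_cut_lt_four (decide (0 ∈ X)) (decide (1 ∈ X)) (decide (2 ∈ X))
    (decide (3 ∈ X)) (decide (4 ∈ X)) (decide (5 ∈ X)) (decide (6 ∈ X)) (decide (7 ∈ X))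
    (decide (8 ∈ X)) (decide (9 ∈ X)) ?_
  · rcases h with h | h
    · left
      intro i hi j hj
      refine subsingleton_of_sum_toNat_le_one (p := fun i => i ∈ X) ?_ hi hj
      rwa [sum_fin_ten]
    · right
      intro i hi j hj
      refine subsingleton_of_sum_toNat_le_one (p := fun i => i ∉ X) ?_ hi hj
      simpa [sum_fin_ten] using h
  · convert hX using 1
    simp only [cutSize, sum_fin_ten, ← ite_edge_eq_boolDiff]
    simp [petersenGraph_adj]
    ring

namespace MarkedGraph

variable {M : MarkedGraph}

open scoped Classical in
theorem cutSize_eq_cutSize_cutGraph (X : Set M.V) : cutSize M.graph X = cutSize M.cutGraph X +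
    boolDiff (decide (M.a ∈ X)) (decide (M.b ∈ X)) +
    boolDiff (decide (M.c ∈ X)) (decide (M.d ∈ X)) := by
  have hab := M.adj_ab.ne
  have hcd := M.adj_cd.ne
  have hac := M.ne_ac
  have had := M.ne_ad
  have hbc := M.ne_bc
  have hbd := M.ne_bd
  have aab := M.adj_ab
  have acd := M.adj_cd
  have aba := M.adj_ab.symm
  have adc := M.adj_cd.symm
  have h : ∀ u v, (if u ∈ X ∧ v ∉ X ∧ M.graph.Adj u v then 1 else 0) =
      (if u ∈ X ∧ v ∉ X ∧ M.cutGraph.Adj u v then 1 else 0) +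
      ((if v = M.b then if u = M.a then if M.a ∈ X ∧ M.b ∉ X then 1 else 0 else 0 else 0) +
      (if v = M.a then if u = M.b then if M.b ∈ X ∧ M.a ∉ X then 1 else 0 else 0 else 0)) +
      ((if v = M.d then if u = M.c then if M.c ∈ X ∧ M.d ∉ X then 1 else 0 else 0 else 0) +
      (if v = M.c then if u = M.d then if M.d ∈ X ∧ M.c ∉ X then 1 else 0 else 0 else 0)) := by
    intro u v
    rw [cutGraph_adj]
    grind
  simp only [cutSize, h, Finset.sum_add_distrib, Finset.sum_ite_eq', Finset.mem_univ, if_true,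
    ← ite_edge_eq_boolDiff]

end MarkedGraph

set_option maxHeartbeats 1000000 in
open scoped Classical in
theorem sum_petersen_rest_edges (p : {h : Fin 10 // h ≠ 0 ∧ h ≠ 1} → Prop) :
    ∑ i, ∑ j, (if p i ∧ ¬ p j ∧ petersenGraph.Adj i.1 j.1 then 1 else 0) =
      boolDiff (decide (p ⟨2, by decide⟩)) (decide (p ⟨3, by decide⟩)) +
      boolDiff (decide (p ⟨2, by decide⟩)) (decide (p ⟨7, by decide⟩)) +
      boolDiff (decide (p ⟨3, by decide⟩)) (decide (p ⟨4, by decide⟩)) +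
      boolDiff (decide (p ⟨3, by decide⟩)) (decide (p ⟨8, by decide⟩)) +
      boolDiff (decide (p ⟨4, by decide⟩)) (decide (p ⟨9, by decide⟩)) +
      boolDiff (decide (p ⟨5, by decide⟩)) (decide (p ⟨7, by decide⟩)) +
      boolDiff (decide (p ⟨5, by decide⟩)) (decide (p ⟨8, by decide⟩)) +
      boolDiff (decide (p ⟨6, by decide⟩)) (decide (p ⟨8, by decide⟩)) +
      boolDiff (decide (p ⟨6, by decide⟩)) (decide (p ⟨9, by decide⟩)) +
      boolDiff (decide (p ⟨7, by decide⟩)) (decide (p ⟨9, by decide⟩)) := by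
  simp only [← ite_edge_eq_boolDiff, sum_petersen_rest, petersenGraph_adj]
  simp
  ring

namespace MarkedGraph

variable {M : MarkedGraph}

open scoped Classical in
theorem cutSize_dotPetersen (X : Set M.dotPetersen.V) : cutSize M.dotPetersen.graph X =
    cutSize M.cutGraph {v | M.old v ∈ X} +
      pieceCut (decide (M.old M.a ∈ X)) (decide (M.old M.b ∈ X)) (decide (M.old M.c ∈ X))
        (decide (M.old M.d ∈ X)) (decide (M.new ⟨2, by decide⟩ ∈ X))
        (decide (M.new ⟨3, by decide⟩ ∈ X)) (decide (M.new ⟨4, by decide⟩ ∈ X))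
        (decide (M.new ⟨5, by decide⟩ ∈ X)) (decide (M.new ⟨6, by decide⟩ ∈ X))
        (decide (M.new ⟨7, by decide⟩ ∈ X)) (decide (M.new ⟨8, by decide⟩ ∈ X))
        (decide (M.new ⟨9, by decide⟩ ∈ X)) := by
  have h1 : ∀ i w, (∀ u, M.dotPetersen.graph.Adj (M.old u) (M.new i) ↔ u = w) →
      (∑ u, if M.old u ∈ X ∧ M.new i ∉ X ∧ M.dotPetersen.graph.Adj (M.old u) (M.new i) then 1 else 0) =
        (if M.old w ∈ X ∧ M.new i ∉ X then 1 else 0) := by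
    intro i w hw
    rw [Finset.sum_eq_single w (fun u _ hu => if_neg fun h => hu ((hw u).1 h.2.2)) (by simp)]
    simp [(hw w).2 rfl]
  have h1' : ∀ i w, (∀ u, M.dotPetersen.graph.Adj (M.old u) (M.new i) ↔ u = w) →
      (∑ u, if M.new i ∈ X ∧ M.old u ∉ X ∧ M.dotPetersen.graph.Adj (M.new i) (M.old u) then 1 else 0) =
        (if M.new i ∈ X ∧ M.old w ∉ X then 1 else 0) := by
    intro i w hw
    rw [Finset.sum_eq_single w (fun u _ hu => if_neg fun h => hu ((hw u).1 h.2.2.symm)) (by simp)]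
    simp [((hw w).2 rfl).symm]
  have h2 : ∀ i, (∀ u, ¬ M.dotPetersen.graph.Adj (M.old u) (M.new i)) →
      (∑ u, if M.old u ∈ X ∧ M.new i ∉ X ∧ M.dotPetersen.graph.Adj (M.old u) (M.new i) then 1 else 0) =
        0 :=
    fun i hi => Finset.sum_eq_zero fun u _ => if_neg fun h => hi u h.2.2
  have h2' : ∀ i, (∀ u, ¬ M.dotPetersen.graph.Adj (M.old u) (M.new i)) →
      (∑ u, if M.new i ∈ X ∧ M.old u ∉ X ∧ M.dotPetersen.graph.Adj (M.new i) (M.old u) then 1 else 0) =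
        0 :=
    fun i hi => Finset.sum_eq_zero fun u _ => if_neg fun h => hi u h.2.2.symm
  have a2 : ∀ u, M.dotPetersen.graph.Adj (M.old u) (M.new ⟨2, by decide⟩) ↔ u = M.c := by
    simp [dotPetersen_adj_old_new]
  have a4 : ∀ u, M.dotPetersen.graph.Adj (M.old u) (M.new ⟨4, by decide⟩) ↔ u = M.a := by
    simp [dotPetersen_adj_old_new]
  have a5 : ∀ u, M.dotPetersen.graph.Adj (M.old u) (M.new ⟨5, by decide⟩) ↔ u = M.b := by
    simp [dotPetersen_adj_old_new]
  have a6 : ∀ u, M.dotPetersen.graph.Adj (M.old u) (M.new ⟨6, by decide⟩) ↔ u = M.d := by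
    simp [dotPetersen_adj_old_new]
  have a3 : ∀ u, ¬ M.dotPetersen.graph.Adj (M.old u) (M.new ⟨3, by decide⟩) := by
    simp [dotPetersen_adj_old_new]
  have a7 : ∀ u, ¬ M.dotPetersen.graph.Adj (M.old u) (M.new ⟨7, by decide⟩) := by
    simp [dotPetersen_adj_old_new]
  have a8 : ∀ u, ¬ M.dotPetersen.graph.Adj (M.old u) (M.new ⟨8, by decide⟩) := by
    simp [dotPetersen_adj_old_new]
  have a9 : ∀ u, ¬ M.dotPetersen.graph.Adj (M.old u) (M.new ⟨9, by decide⟩) := by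
    simp [dotPetersen_adj_old_new]
  have h3 : ∑ u, ∑ i, (if M.old u ∈ X ∧ M.new i ∉ X ∧ M.dotPetersen.graph.Adj (M.old u) (M.new i)
      then 1 else 0) = (if M.old M.c ∈ X ∧ M.new ⟨2, by decide⟩ ∉ X then 1 else 0) + 0 +
      (if M.old M.a ∈ X ∧ M.new ⟨4, by decide⟩ ∉ X then 1 else 0) +
      (if M.old M.b ∈ X ∧ M.new ⟨5, by decide⟩ ∉ X then 1 else 0) +
      (if M.old M.d ∈ X ∧ M.new ⟨6, by decide⟩ ∉ X then 1 else 0) + 0 + 0 + 0 := by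
    rw [Finset.sum_comm, sum_petersen_rest, h1 _ _ a2, h2 _ a3, h1 _ _ a4, h1 _ _ a5, h1 _ _ a6,
      h2 _ a7, h2 _ a8, h2 _ a9]
  have h4 : ∑ i, ∑ u, (if M.new i ∈ X ∧ M.old u ∉ X ∧ M.dotPetersen.graph.Adj (M.new i) (M.old u)
      then 1 else 0) = (if M.new ⟨2, by decide⟩ ∈ X ∧ M.old M.c ∉ X then 1 else 0) + 0 +
      (if M.new ⟨4, by decide⟩ ∈ X ∧ M.old M.a ∉ X then 1 else 0) +
      (if M.new ⟨5, by decide⟩ ∈ X ∧ M.old M.b ∉ X then 1 else 0) +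
      (if M.new ⟨6, by decide⟩ ∈ X ∧ M.old M.d ∉ X then 1 else 0) + 0 + 0 + 0 := by
    rw [sum_petersen_rest, h1' _ _ a2, h2' _ a3, h1' _ _ a4, h1' _ _ a5, h1' _ _ a6,
      h2' _ a7, h2' _ a8, h2' _ a9]
  have h5 : ∑ u, ∑ v, (if M.old u ∈ X ∧ M.old v ∉ X ∧ M.dotPetersen.graph.Adj (M.old u) (M.old v)
      then 1 else 0) = cutSize M.cutGraph {v | M.old v ∈ X} := by
    refine Finset.sum_congr rfl fun u _ => Finset.sum_congr rfl fun v _ => if_congr ?_ rfl rfl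
    rw [dotPetersen_adj_old_old]
    rfl
  have h6 : ∑ i, ∑ j, (if M.new i ∈ X ∧ M.new j ∉ X ∧ M.dotPetersen.graph.Adj (M.new i) (M.new j)
      then 1 else 0) = ∑ i, ∑ j, (if M.new i ∈ X ∧ M.new j ∉ X ∧ petersenGraph.Adj i.1 j.1
      then 1 else 0) := by
    refine Finset.sum_congr rfl fun u _ => Finset.sum_congr rfl fun v _ => if_congr ?_ rfl rfl
    rw [dotPetersen_adj_new_new]
  rw [sum_petersen_rest_edges fun i => M.new i ∈ X] at h6
  rw [cutSize]
  simp only [sum_dotPetersen, Finset.sum_add_distrib]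
  rw [h3, h4, h5, h6]
  simp only [pieceCut, ← ite_edge_eq_boolDiff]
  ring

/-- Restricting a set to the old vertices does not enlarge its cut, so by hypothesis the restriction
or its complement has at most one vertex. By passing to the complement the first may be assumed, and
the finite checks on the piece finish. -/
theorem onlyTrivialSmallCuts_dotPetersen (hM : OnlyTrivialSmallCuts M.graph) (hc : IsCubic M.graph) :
    OnlyTrivialSmallCuts M.dotPetersen.graph := by
  classical
  have key : ∀ X : Set M.dotPetersen.V, cutSize M.dotPetersen.graph X < 4 →
      {v | M.old v ∈ X}.Subsingleton → X.Subsingleton := by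
    intro X hX hs
    rw [cutSize_dotPetersen] at hX
    have hab := M.adj_ab.ne
    have hcd := M.adj_cd.ne
    have hac := M.ne_ac
    have had := M.ne_ad
    have hbc := M.ne_bc
    have hbd := M.ne_bd
    have hsum := cutSize_eq_cutSize_cutGraph {v | M.old v ∈ X}
    simp only [Set.mem_ofPred_eq] at hsum
    rcases hs.eq_empty_or_singleton with h0 | ⟨w, h0⟩
    · have hmem : ∀ v, M.old v ∉ X := fun v hv => by
        have : v ∈ {v | M.old v ∈ X} := hv
        rw [h0] at this
        exact this
      simp only [hmem, decide_false] at hX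
      have h1 := count_le_one_of_pieceCut_lt_four _ _ _ _ _ _ _ _
        (lt_of_le_of_lt (Nat.le_add_left _ _) hX)
      intro x hx y hy
      obtain ⟨u, rfl⟩ | ⟨i, rfl⟩ := eq_old_or_eq_new x
      · exact absurd hx (hmem u)
      obtain ⟨u, rfl⟩ | ⟨j, rfl⟩ := eq_old_or_eq_new y
      · exact absurd hy (hmem u)
      rw [new_inj]
      refine subsingleton_of_sum_toNat_le_one (p := fun i => M.new i ∈ X) ?_ hx hy
      rwa [sum_petersen_rest]
    · have hmem : ∀ v, M.old v ∈ X ↔ v = w := fun v => by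
        have : v ∈ {v | M.old v ∈ X} ↔ v ∈ ({w} : Set M.V) := by rw [h0]
        simpa using this
      -- The old vertex `w` already has three edges. Those not deleted stay in the cut, so fewer
      -- than four cut edges leave the piece at most as many as there are selected ends at `w`.
      have h3 := three_le_cutSize_singleton hc w
      rw [← h0, hsum] at h3
      have h4 : (decide (M.old M.a ∈ X)).toNat + (decide (M.old M.b ∈ X)).toNat +
          (decide (M.old M.c ∈ X)).toNat + (decide (M.old M.d ∈ X)).toNat ≤ 1 ∧
          boolDiff (decide (M.old M.a ∈ X)) (decide (M.old M.b ∈ X)) +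
          boolDiff (decide (M.old M.c ∈ X)) (decide (M.old M.d ∈ X)) ≤
          (decide (M.old M.a ∈ X)).toNat + (decide (M.old M.b ∈ X)).toNat +
          (decide (M.old M.c ∈ X)).toNat + (decide (M.old M.d ∈ X)).toNat := by
        simp only [hmem]
        by_cases ha : M.a = w
        · subst ha
          simp [hab.symm, hac.symm, had.symm, boolDiff]
        by_cases hb : M.b = w
        · subst hb
          simp [ha, hbc.symm, hbd.symm, boolDiff]
        by_cases hc : M.c = w
        · subst hc
          simp [ha, hb, hcd.symm, boolDiff]
        by_cases hd : M.d = w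
        · simp [ha, hb, hc, hd, boolDiff]
        · simp [ha, hb, hc, hd, boolDiff]
      have h5 := count_eq_zero_of_pieceCut_le _ _ _ _ h4.1 (decide (M.new ⟨2, by decide⟩ ∈ X))
        (decide (M.new ⟨3, by decide⟩ ∈ X)) (decide (M.new ⟨4, by decide⟩ ∈ X))
        (decide (M.new ⟨5, by decide⟩ ∈ X)) (decide (M.new ⟨6, by decide⟩ ∈ X))
        (decide (M.new ⟨7, by decide⟩ ∈ X)) (decide (M.new ⟨8, by decide⟩ ∈ X))
        (decide (M.new ⟨9, by decide⟩ ∈ X)) (by omega)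
      have h6 : ∀ i, M.new i ∉ X := by
        rw [forall_petersen_rest]
        simpa [and_assoc] using h5
      intro x hx y hy
      obtain ⟨u, rfl⟩ | ⟨i, rfl⟩ := eq_old_or_eq_new x
      · obtain ⟨v, rfl⟩ | ⟨j, rfl⟩ := eq_old_or_eq_new y
        · rw [(hmem u).1 hx, (hmem v).1 hy]
        · exact absurd hy (h6 j)
      · exact absurd hx (h6 i)
  intro X hX
  have h1 : cutSize M.graph {v | M.old v ∈ X} < 4 := by
    refine lt_of_le_of_lt ?_ hX
    rw [cutSize_dotPetersen, cutSize_eq_cutSize_cutGraph, add_assoc]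
    exact Nat.add_le_add_left (boolDiff_add_le_pieceCut _ _ _ _ _ _ _ _ _ _ _ _) _
  rcases hM _ h1 with h | h
  · exact Or.inl (key X hX h)
  · exact Or.inr (key Xᶜ ((cutSize_compl _ X).trans_lt hX) h)

end MarkedGraph

theorem cyclicallyEdgeConnected_snarkFamily (n : ℕ) :
    CyclicallyEdgeConnected (snarkFamily (n + 1)).graph 4 := by
  refine OnlyTrivialSmallCuts.cyclicallyEdgeConnected ?_
  induction n with
  | zero => exact onlyTrivialSmallCuts_petersenGraph
  | succ n ih => exact MarkedGraph.onlyTrivialSmallCuts_dotPetersen ih (isCubic_snarkFamily n)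

theorem mainTheorem1 (k : ℕ) (hk : 1 ≤ k) :
    IsSnark (snarkFamily k).graph ∧
      Fintype.card (snarkFamily k).V = 8 * k + 2 ∧
      IsCircularFlowNumber (snarkFamily k).graph (4 + 1 / (k : ℝ)) := by
  refine ⟨?_, ?_, isCircularFlowNumber_snarkFamily hk⟩
  · have h := not_colorable_snarkFamily hk
    obtain ⟨n, rfl⟩ := Nat.exists_eq_add_of_le' hk
    exact ⟨isCubic_snarkFamily n, cyclicallyEdgeConnected_snarkFamily n,
      five_le_egirth_snarkFamily n, h⟩
  · obtain ⟨n, rfl⟩ := Nat.exists_eq_add_of_le' hk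
    exact card_snarkFamily n
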